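/- Setting. Let $\mathbb S\subset\mathbb R^3$ be the unit sphere with surface measure $d\xi$ of mass $4\pi$, let $\mathbb H_\ell$ be the space of spherical harmonics of degree $\ell$, $\mathcal Y_{\ell,m}$ ($-\ell\le m\le \ell$) its usual orthonormal basis, and $L_\ell$ the Legendre polynomial of degree $\ell$ normalized by $L_\ell(1)=\frac{2\ell+1}{4\pi}$. Let $X$ be a (jointly measurable) real, centered, mean-square continuous, second-order stationary Gaussian random field on $\mathbb S$, with coefficients $a_{\ell,m}=\langle X,\mathcal Y_{\ell,m}\rangle_{L^2(\mathbb S)}$ and angular power spectrum $C_\ell=\mathbf E|a_{\ell,m}|^2$. Fix $\mathcal B>1$, an integer $M\ge 3$ and an $M$ times differentiable function $\mathbf a:\mathbb R\to\mathbb R$ supported in $[-\mathcal B,\mathcal B]$ and equal to $1$ on $[-\mathcal B^{-1},\mathcal B^{-1}]$; put $\mathbf b(x)=\mathbf a(x/\mathcal B)-\mathbf a(x)$ and $b_{j,\ell}=\mathbf b(\mathcal B^{-j}\ell)$. Assume that for some $\alpha>2$ one has $C_\ell=\ell^{-\alpha}\mathbf g_j(\mathcal B^{-j}\ell)$ for all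 $j\in\mathbb N$ and $\ell\in[\mathcal B^{j-1},\mathcal B^{j+1}]$, where the functions $\mathbf g_j$ are $M$ times differentiable on $[\mathcal B^{-1},\mathcal B]$ and, for positive constants $c_0,\dots,c_M$ independent of $j$, satisfy $c_0^{-1}\le \mathbf g_j\le c_0$ and $|\mathbf g_j^{(r)}|\le c_r$ for all $r\le M$. Put $C^{(j)}=\frac1{4\pi}\sum_{\ell\ge0}(2\ell+1)b_{j,\ell}^2C_\ell$. For every scale $j\in\mathbb N$ let $L_j\ge1$ be an integer, non-decreasing in $j$, such that $b_{j,\ell}=0$ for $\ell>L_j$ and $L_j\le\kappa\mathcal B^j$ with $\kappa$ independent of $j$. Let $(\xi_{j,k},\lambda_{j,k})_{1\le k\le N_j}$ be a pixelization of order $L=4L_j$: points of $\mathbb S$ and positive weights with $\int f\,d\xi=\sum_k\lambda_{j,k}f(\xi_{j,k})$ for all $f\in\bigoplus_{\ell\le L}\mathbb H_\ell$, such that $N_j/L^2$, $L^2\lambda_{j,k}$, $L\sup_\xi\min_kd(\xi,\xi_{j,k})$ and $L\min_{k\ne k'}d(\xi_{j,k},\xi_{j,k'})$ lie between two positive constants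 independent of $j$ and $k$, where $d$ is the geodesic distance. Let $W_{j,k}\in[0,1]$ (the mask), $\sigma_{j,k}\ge0$, and let $\mathbf B_{j,\ell}\in\mathbb R$ satisfy $\mathbf B_{j,\ell}=1$ for $\ell\le L_j$ and $\mathbf B_{j,\ell}=0$ for $\ell>2L_j$. One observes $$Y_{j,k}=W_{j,k}\big(X_j(\xi_{j,k})+\sigma_{j,k}U_{j,k}\big),\qquad X_j=\sum_{\ell\ge0}\sum_{m=-\ell}^{\ell}\mathbf B_{j,\ell}\,a_{\ell,m}\mathcal Y_{\ell,m},$$ with independent standard Gaussian $U_{j,k}$, independent of $X$. Put $\psi_{j,k}(\xi)=\sqrt{\lambda_{j,k}}\sum_\ell b_{j,\ell}L_\ell(\xi\cdot\xi_{j,k})$, $$\gamma_{j,k}=\lambda_{j,k}^{-1/2}\sum_p\lambda_{j,p}\psi_{j,k}(\xi_{j,p})Y_{j,p},\qquad n_{j,k}^2=\lambda_{j,k}^{-1}\sum_p\big(\lambda_{j,p}W_{j,p}\sigma_{j,p}\psi_{j,k}(\xi_{j,p})\big)^2 .$$ For thresholds $t_j\in\mathbb R$ let $\mathcal K_j=\{k:\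 (\sum_p\lambda_{j,p}(1-W_{j,p})^2\psi_{j,k}(\xi_{j,p})^2)^{1/2}\le t_j\}$, and for real weights with $\sum_kw_{j,k}=1$ let $\widehat C^{(j)}=\sum_kw_{j,k}(\gamma_{j,k}^2-n_{j,k}^2)$. **Proposition 7.** (i) Suppose that $\sup_{j,\ell}|\mathbf B_{j,\ell}|<\infty$. For every $A$ there is a constant $c>0$ such that, for all thresholds $(t_j)$, all weights and all $j$ with $\sum_kw_{j,k}=1$, $\sum_k|w_{j,k}|\le A$ (for nonnegative weights, $A=1$) and $w_{j,k}=0$ for $k\notin\mathcal K_j$, the estimator $\widehat C^{(j)}$ is integrable and $$|\mathbf E\widehat C^{(j)}-C^{(j)}|\le c\,\mathcal B^{\alpha j}\,t_j\,C^{(j)},$$ that is, $|\mathbf E\widehat C^{(j)}-C^{(j)}|/C^{(j)}\le c\,\mathcal B^{\alpha j}t_j$ whenever $C^{(j)}\ne0$. (ii) If $W_{j,k}=1$ for all $k$ (no mask), then for every choice of real weights with $\sum_kw_{j,k}=1$ the estimator $\widehat C^{(j)}$ is integrable and $\mathbf E\widehat C^{(j)}=C^{(j)}$. -/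

import Mathlib

open MeasureTheory ProbabilityTheory Filter Topology

noncomputable section

namespace Needlet

/-! ### The unit sphere of `ℝ³` -/

/-- The unit sphere in Euclidean three-space. -/
abbrev S2 : Type := Metric.sphere (0 : EuclideanSpace ℝ (Fin 3)) 1

/-- The rotation-invariant surface measure on the sphere, of total mass `4π`. -/
def sphereMeasure : Measure S2 :=
  (volume : Measure (EuclideanSpace ℝ (Fin 3))).toSphere

/-- The dot product of two points of the sphere, seen as vectors of `ℝ³`. -/
def dot (x y : S2) : ℝ := inner ℝ (x : EuclideanSpace ℝ (Fin 3)) (y : EuclideanSpace ℝ (Fin 3))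

/-- The geodesic distance. -/
def geoDist (x y : S2) : ℝ := Real.arccos (dot x y)

/-- The action of a linear isometry of `ℝ³` on the sphere. -/
def rotate (ρ : EuclideanSpace ℝ (Fin 3) ≃ₗᵢ[ℝ] EuclideanSpace ℝ (Fin 3)) (x : S2) : S2 :=
  ⟨ρ (x : EuclideanSpace ℝ (Fin 3)), by
    simp [ρ.norm_map (x : EuclideanSpace ℝ (Fin 3))]⟩

/-! ### Spherical harmonics -/

/-- The algebraic Laplacian on complex polynomials in three variables. -/
def polyLaplacian : MvPolynomial (Fin 3) ℂ →ₗ[ℂ] MvPolynomial (Fin 3) ℂ :=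
  ∑ i : Fin 3, (MvPolynomial.pderiv (R := ℂ) i).toLinearMap ∘ₗ
    (MvPolynomial.pderiv (R := ℂ) i).toLinearMap

/-- Restriction of a complex polynomial to the sphere. -/
def restrictToSphere : MvPolynomial (Fin 3) ℂ →ₗ[ℂ] (S2 → ℂ) where
  toFun p x := MvPolynomial.eval
    (fun i : Fin 3 => (((x : EuclideanSpace ℝ (Fin 3)) i : ℝ) : ℂ)) p
  map_add' p q := by
    funext x
    simp
  map_smul' r p := by
    funext x
    simp [MvPolynomial.smul_eval]

/-- `ℍ_ℓ`: restrictions to the sphere of harmonic homogeneous polynomials of degree `ℓ`. -/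
def harmonicSpace (ℓ : ℕ) : Submodule ℂ (S2 → ℂ) :=
  (MvPolynomial.homogeneousSubmodule (Fin 3) ℂ ℓ ⊓ LinearMap.ker polyLaplacian).map
    restrictToSphere

/-- The Legendre polynomial with the usual normalization `P_ℓ(1) = 1` (Rodrigues' formula). -/
def legendreP (ℓ : ℕ) : Polynomial ℝ :=
  Polynomial.C ((1 : ℝ) / (2 ^ ℓ * (ℓ.factorial : ℝ))) *
    (Polynomial.derivative^[ℓ] ((Polynomial.X ^ 2 - 1) ^ ℓ))

/-- The Legendre polynomial `L_ℓ`, normalized by `L_ℓ(1) = (2ℓ+1)/(4π)`, as a function. -/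
def legendreL (ℓ : ℕ) (u : ℝ) : ℝ :=
  (2 * (ℓ : ℝ) + 1) / (4 * Real.pi) * (legendreP ℓ).eval u

/-- The usual spherical harmonic `𝒴_{ℓ,m}`, `-ℓ ≤ m ≤ ℓ`, in Cartesian form. For `m ≥ 0`, with
`ξ = (sin θ cos φ, sin θ sin φ, cos θ)`, one has
`(ξ₀ + i ξ₁)^m P_ℓ^{(m)}(ξ₂) = e^{imφ} (sin θ)^m P_ℓ^{(m)}(cos θ)`. The phases are chosen so that
`𝒴_{ℓ,-m}` is the complex conjugate of `𝒴_{ℓ,m}`. -/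
def sphericalHarmonic (ℓ : ℕ) (m : ℤ) (x : S2) : ℂ :=
  ((Real.sqrt ((2 * (ℓ : ℝ) + 1) / (4 * Real.pi) *
      (((ℓ - m.natAbs).factorial : ℝ) / ((ℓ + m.natAbs).factorial : ℝ))) : ℝ) : ℂ) *
  ((((x : EuclideanSpace ℝ (Fin 3)) 0 : ℝ) : ℂ) +
      (if 0 ≤ m then Complex.I else -Complex.I) *
        (((x : EuclideanSpace ℝ (Fin 3)) 1 : ℝ) : ℂ)) ^ m.natAbs *
  (((Polynomial.derivative^[m.natAbs] (legendreP ℓ)).eval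
      ((x : EuclideanSpace ℝ (Fin 3)) 2) : ℝ) : ℂ)

/-! ### Random fields on the sphere -/

/-- A real-valued random field on the sphere (jointly measurable in the point and the outcome)
that is square integrable, centered, mean square continuous, second-order stationary and
Gaussian. -/
structure IsStationaryGaussianField {Ω : Type*} [MeasurableSpace Ω]
    (X : S2 → Ω → ℝ) (P : Measure Ω) : Prop where
  measurable : Measurable (fun z : S2 × Ω => X z.1 z.2)
  memLp : ∀ x, MemLp (X x) 2 P
  centered : ∀ x, ∫ ω, X x ω ∂P = 0
  meanSquareContinuous : ∀ x₀,
    Tendsto (fun x => ∫ ω, (X x ω - X x₀ ω) ^ 2 ∂P) (𝓝 x₀) (𝓝 0)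
  stationary : ∀ ρ : EuclideanSpace ℝ (Fin 3) ≃ₗᵢ[ℝ] EuclideanSpace ℝ (Fin 3),
    LinearMap.det (ρ.toLinearEquiv : EuclideanSpace ℝ (Fin 3) →ₗ[ℝ] EuclideanSpace ℝ (Fin 3)) = 1 →
    ∀ x y, ∫ ω, X (rotate ρ x) ω * X (rotate ρ y) ω ∂P = ∫ ω, X x ω * X y ω ∂P
  gaussian : IsGaussianProcess X P

/-- The random spherical harmonic coefficient `a_{ℓ,m} = ⟨X, 𝒴_{ℓ,m}⟩`. -/
def harmonicCoeff {Ω : Type*} (X : S2 → Ω → ℝ) (ℓ : ℕ) (m : ℤ) (ω : Ω) : ℂ :=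
  ∫ x, (X x ω : ℂ) * (starRingEnd ℂ) (sphericalHarmonic ℓ m x) ∂sphereMeasure

/-- The angular power spectrum `C_ℓ = E|a_{ℓ,m}|²`. For a stationary field this does not depend
on `m`; the definition takes the mean over the `2ℓ+1` values of `m`. -/
def powerSpectrum {Ω : Type*} [MeasurableSpace Ω] (X : S2 → Ω → ℝ) (P : Measure Ω) (ℓ : ℕ) : ℝ :=
  (1 / (2 * (ℓ : ℝ) + 1)) *
    ∑ m ∈ Finset.Icc (-(ℓ : ℤ)) (ℓ : ℤ), ∫ ω, ‖harmonicCoeff X ℓ m ω‖ ^ 2 ∂P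

/-! ### Pixelizations -/

/-- `(ξ_k, λ_k)_k` is a pixelization of order `L`, with constant `c₀`. -/
structure IsPixelization (c₀ : ℝ) (L N : ℕ) (ξ : Fin N → S2) (lam : Fin N → ℝ) : Prop where
  weight_pos : ∀ k, 0 < lam k
  /-- cubature formula on `⨁_{ℓ ≤ L} ℍ_ℓ` -/
  cubature : ∀ f ∈ ⨆ ℓ ∈ Set.Iic L, harmonicSpace ℓ,
    ∫ x, f x ∂sphereMeasure = ∑ k, (lam k : ℂ) * f (ξ k)
  card_lower : c₀⁻¹ * (L : ℝ) ^ 2 ≤ N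
  card_upper : (N : ℝ) ≤ c₀ * (L : ℝ) ^ 2
  weight_lower : ∀ k, c₀⁻¹ * ((L : ℝ) ^ 2)⁻¹ ≤ lam k
  weight_upper : ∀ k, lam k ≤ c₀ * ((L : ℝ) ^ 2)⁻¹
  /-- lower bound on the (attained) covering radius -/
  covering_lower : ∃ x, ∀ k, c₀⁻¹ * (L : ℝ)⁻¹ ≤ geoDist x (ξ k)
  covering_upper : ∀ x, ∃ k, geoDist x (ξ k) ≤ c₀ * (L : ℝ)⁻¹
  separation_lower : ∀ k k', k ≠ k' → c₀⁻¹ * (L : ℝ)⁻¹ ≤ geoDist (ξ k) (ξ k')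
  separation_upper : ∃ k k', k ≠ k' ∧ geoDist (ξ k) (ξ k') ≤ c₀ * (L : ℝ)⁻¹

/-! ### Window functions and the regularity of the spectrum -/

/-- The function `a` is `M` times differentiable, supported in `[-B, B]` and identically `1` on
`[-1/B, 1/B]`. -/
structure IsWindowProfile (B : ℝ) (M : ℕ) (a : ℝ → ℝ) : Prop where
  differentiable : ∀ r < M, Differentiable ℝ (iteratedDeriv r a)
  support : Function.support a ⊆ Set.Icc (-B) B
  eq_one : ∀ x ∈ Set.Icc (-B⁻¹) B⁻¹, a x = 1

/-- The `B`-adic window `b_{j,ℓ} = b(B^{-j} ℓ)`, where `b(x) = a(x / B) - a(x)`. -/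
def window (B : ℝ) (a : ℝ → ℝ) (j ℓ : ℕ) : ℝ :=
  a ((ℓ : ℝ) / B ^ j / B) - a ((ℓ : ℝ) / B ^ j)

/-- Regularity of a power spectrum: `C_ℓ = ℓ^{-α} g_j(B^{-j} ℓ)` for `B^{j-1} ≤ ℓ ≤ B^{j+1}`, where
the `g_j` are `M` times differentiable on `[1/B, B]`, bounded above and away from zero uniformly
in `j`, with derivatives up to order `M` bounded uniformly in `j`. -/
def IsRegularSpectrum (B : ℝ) (M : ℕ) (α : ℝ) (C : ℕ → ℝ) : Prop :=
  ∃ (g : ℕ → ℝ → ℝ) (c : ℕ → ℝ),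
    (∀ r ≤ M, 0 < c r) ∧
    (∀ j ℓ : ℕ, B ^ ((j : ℤ) - 1) ≤ (ℓ : ℝ) → (ℓ : ℝ) ≤ B ^ (j + 1) →
      C ℓ = (ℓ : ℝ) ^ (-α) * g j ((ℓ : ℝ) / B ^ j)) ∧
    (∀ j, ∀ u ∈ Set.Icc B⁻¹ B, (c 0)⁻¹ ≤ g j u ∧ g j u ≤ c 0) ∧
    (∀ j, ∀ r < M, DifferentiableOn ℝ (iteratedDerivWithin r (g j) (Set.Icc B⁻¹ B))
      (Set.Icc B⁻¹ B)) ∧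
    (∀ j, ∀ r ≤ M, ∀ u ∈ Set.Icc B⁻¹ B,
      |iteratedDerivWithin r (g j) (Set.Icc B⁻¹ B) u| ≤ c r)

/-- The smoothed spectrum `C^{(j)} = (4π)⁻¹ ∑_ℓ (2ℓ+1) b_{j,ℓ}² C_ℓ` (a finite sum). -/
def bandSpectrum (B : ℝ) (a : ℝ → ℝ) (C : ℕ → ℝ) (j : ℕ) : ℝ :=
  (4 * Real.pi)⁻¹ * ∑' ℓ : ℕ, (2 * (ℓ : ℝ) + 1) * window B a j ℓ ^ 2 * C ℓ

/-! ### The observation model -/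

/-- The deterministic data of the observation model, at all scales `j`: resolutions `L_j` covering
the window `b_j` and of order `B^j` (with constant `κ`), pixelizations of order `4 L_j`,
masks `W_j` with values in `[0,1]`, noise levels `σ_j ≥ 0`, and low-pass filters `𝐁_j`. -/
structure Design (B : ℝ) (a : ℝ → ℝ) (c₀ κ : ℝ) where
  L : ℕ → ℕ
  L_pos : ∀ j, 1 ≤ L j
  L_mono : Monotone L
  window_band : ∀ j ℓ, L j < ℓ → window B a j ℓ = 0
  L_le : ∀ j, (L j : ℝ) ≤ κ * B ^ j
  N : ℕ → ℕ
  ξ : ∀ j, Fin (N j) → S2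
  lam : ∀ j, Fin (N j) → ℝ
  pixelization : ∀ j, IsPixelization c₀ (4 * L j) (N j) (ξ j) (lam j)
  W : ∀ j, Fin (N j) → ℝ
  W_mem : ∀ j k, W j k ∈ Set.Icc (0 : ℝ) 1
  σ : ∀ j, Fin (N j) → ℝ
  σ_nonneg : ∀ j k, 0 ≤ σ j k
  beam : ℕ → ℕ → ℝ
  beam_low : ∀ j ℓ, ℓ ≤ L j → beam j ℓ = 1
  beam_high : ∀ j ℓ, 2 * L j < ℓ → beam j ℓ = 0

namespace Design

variable {B : ℝ} {a : ℝ → ℝ} {c₀ κ : ℝ} (D : Design B a c₀ κ)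

/-- The array `U` consists of independent standard Gaussian variables and is independent of the
process `X`. -/
structure IsNoise {Ω : Type*} [MeasurableSpace Ω] (X : S2 → Ω → ℝ)
    (U : (Σ j : ℕ, Fin (D.N j)) → Ω → ℝ) (P : Measure Ω) : Prop where
  measurable : ∀ i, Measurable (U i)
  law : ∀ i, P.map (U i) = gaussianReal 0 1
  indep : iIndepFun U P
  indep_field : IndepFun (fun ω x => X x ω) (fun ω i => U i ω) P

/-- The low-passed field `X_j = ∑_ℓ ∑_m 𝐁_{j,ℓ} a_{ℓ,m} 𝒴_{ℓ,m}` (a finite sum). The sum is real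
since `X` is real; the real part only records this. -/
def lowPass {Ω : Type*} (X : S2 → Ω → ℝ) (j : ℕ) (x : S2) (ω : Ω) : ℝ :=
  (∑' ℓ : ℕ, ∑ m ∈ Finset.Icc (-(ℓ : ℤ)) (ℓ : ℤ),
    (D.beam j ℓ : ℂ) * harmonicCoeff X ℓ m ω * sphericalHarmonic ℓ m x).re

/-- The observations `Y_{j,k} = W_{j,k} (X_j(ξ_{j,k}) + σ_{j,k} U_{j,k})`. -/
def obs {Ω : Type*} (X : S2 → Ω → ℝ) (U : (Σ j : ℕ, Fin (D.N j)) → Ω → ℝ)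
    (j : ℕ) (k : Fin (D.N j)) (ω : Ω) : ℝ :=
  D.W j k * (D.lowPass X j (D.ξ j k) ω + D.σ j k * U ⟨j, k⟩ ω)

/-- The needlet `ψ_{j,k}(ξ) = √λ_{j,k} ∑_ℓ b_{j,ℓ} L_ℓ(ξ · ξ_{j,k})` (a finite sum). -/
def needlet (j : ℕ) (k : Fin (D.N j)) (x : S2) : ℝ :=
  Real.sqrt (D.lam j k) * ∑' ℓ : ℕ, window B a j ℓ * legendreL ℓ (dot x (D.ξ j k))

/-- The needlet coefficients `λ_{j,k}^{-1/2} ∑_p λ_{j,p} ψ_{j,k}(ξ_{j,p}) f_p` of a finite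
sequence `f`. -/
def needletCoeff (j : ℕ) (f : Fin (D.N j) → ℝ) (k : Fin (D.N j)) : ℝ :=
  (Real.sqrt (D.lam j k))⁻¹ * ∑ p, D.lam j p * D.needlet j k (D.ξ j p) * f p

/-- The standard deviation `n_{j,k}` of the needlet coefficients of the masked noise. -/
def noiseLevel (j : ℕ) (k : Fin (D.N j)) : ℝ :=
  Real.sqrt ((D.lam j k)⁻¹ *
    ∑ p, (D.lam j p * (D.W j p * D.σ j p) * D.needlet j k (D.ξ j p)) ^ 2)

/-- The set `𝒦_j` of kept coefficients for the threshold `t`. -/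
def kept (j : ℕ) (t : ℝ) : Set (Fin (D.N j)) :=
  {k | Real.sqrt (∑ p, D.lam j p * (1 - D.W j p) ^ 2 * D.needlet j k (D.ξ j p) ^ 2) ≤ t}

/-- The needlet spectral estimator `Ĉ^{(j)} = ∑_k w_{j,k} (γ_{j,k}² - n_{j,k}²)`, where the
`γ_{j,k}` are the needlet coefficients of the observations. -/
def estimator {Ω : Type*} (X : S2 → Ω → ℝ) (U : (Σ j : ℕ, Fin (D.N j)) → Ω → ℝ)
    (j : ℕ) (w : Fin (D.N j) → ℝ) (ω : Ω) : ℝ :=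
  ∑ k, w k * (D.needletCoeff j (fun p => D.obs X U j p ω) k ^ 2 - D.noiseLevel j k ^ 2)

end Design

end Needlet

end

open MeasureTheory ProbabilityTheory Filter Topology

noncomputable section

namespace Needlet

/-! ### Legendre polynomials -/

section Legendre

open Polynomial

/-! The coefficient `γ_{j,k}` is linear in the data, so it splits into a masked signal part and a
noise part. The noise is centred, white and orthogonal to the field, so the second moment of
`γ_{j,k}` is that of the signal part plus exactly `n_{j,k}²`. The bias is therefore a weighted sum,
over the pixels `k`, of the masked second moment minus `C^{(j)}`.

Without a mask each term of this sum vanishes. The low-passed field is the convolution of `X` with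
the zonal kernel `∑ 𝐁_{j,ℓ} L_ℓ`. The cubature is exact on the product of this kernel with the
needlet kernel, and the window satisfies `b 𝐁 = b`. Hence the coefficient is the convolution of `X`
with `∑ b_{j,ℓ} L_ℓ`, whose variance is `C^{(j)}` (`integral_fullCoeff_sq`). This variance formula
does not need decorrelation of the `a_{ℓ,m}`: by stationarity the variance does not depend on the
point. Averaging over the sphere turns the squared kernel into `∑ c_ℓ² L_ℓ` by the reproducing
property, and the addition theorem identifies the covariance integral of `L_ℓ` with `(2ℓ+1) C_ℓ`
(`integral_sq_fieldIntegral_zonal`).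

With a mask, the difference of squares is factored and Cauchy–Schwarz over the pixels is applied to
each factor (`abs_maskedCoeff_sq_sub_le`). The difference costs `t λ^{-1/2}`, the sum costs the norm
of the kernel, and the two share the pixel energy. That energy has bounded mean because `∑ (2ℓ+1)
C_ℓ` converges for `α > 2`. Both `λ^{-1/2}` and the kernel norm are `O(B^j)`, so the bias is `O(t
B^{2j})`. Finally `C^{(j)}` is at least of order `B^{(2-α)j}` unless the window vanishes at every
integer (`exists_bandSpectrum_lower_bound`), in which case bias and spectrum are both zero.

The harmonic analysis rests on three facts: the addition theorem, obtained from invariance of the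
kernel under two one-parameter groups of rotations; the orthogonality of Legendre polynomials,
obtained from Legendre's equation; and the decomposition of polynomials on the sphere into
harmonics, which makes the cubature applicable to zonal kernels. -/

lemma eval_iterate_derivative_eq_taylor_coeff (p : ℝ[X]) (n : ℕ) (r : ℝ) :
    (derivative^[n] p).eval r = (n.factorial : ℝ) * (taylor r p).coeff n := by
  rw [taylor_coeff, ← factorial_smul_hasseDeriv]
  simp

/-- At an endpoint `r = ±1` the polynomial `X² - 1` recentres to `X (X + 2r)`. The factor `X^ℓ` of
its power leaves only the constant term of `(X + 2r)^ℓ`. -/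
lemma taylor_sq_sub_one_pow_coeff (r : ℝ) (hr : r ^ 2 = 1) (ℓ : ℕ) :
    (taylor r ((X ^ 2 - 1 : ℝ[X]) ^ ℓ)).coeff ℓ = (2 * r) ^ ℓ := by
  have h : taylor r ((X ^ 2 - 1 : ℝ[X]) ^ ℓ) = X ^ ℓ * (X + C (2 * r)) ^ ℓ := by
    rw [taylor_pow, ← mul_pow]
    congr 1
    have hC : (C r : ℝ[X]) ^ 2 = 1 := by rw [← C_pow, hr, C_1]
    simp only [map_sub, taylor_pow, taylor_X, taylor_one, C_mul, map_ofNat, map_one]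
    linear_combination hC
  rw [h, coeff_X_pow_mul', if_pos le_rfl, Nat.sub_self, coeff_zero_eq_eval_zero]
  simp

lemma legendreP_eval_of_sq_eq_one (r : ℝ) (hr : r ^ 2 = 1) (ℓ : ℕ) :
    (legendreP ℓ).eval r = r ^ ℓ := by
  have h1 : (2 : ℝ) ^ ℓ ≠ 0 := by positivity
  have h2 : (ℓ.factorial : ℝ) ≠ 0 := by positivity
  rw [legendreP, eval_mul, eval_C, eval_iterate_derivative_eq_taylor_coeff,
    taylor_sq_sub_one_pow_coeff r hr]
  field_simp
  ring

lemma legendreP_eval_one (ℓ : ℕ) : (legendreP ℓ).eval 1 = 1 := by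
  simp [legendreP_eval_of_sq_eq_one 1 (by norm_num) ℓ]

lemma natDegree_legendreP (ℓ : ℕ) : (legendreP ℓ).natDegree = ℓ := by
  have hm : ((X ^ 2 - 1 : ℝ[X]) ^ ℓ).Monic := by
    have : (X ^ 2 - 1 : ℝ[X]).Monic := by
      simpa using monic_X_pow_sub_C (1 : ℝ) (n := 2) (by norm_num)
    exact this.pow ℓ
  have hd : ((X ^ 2 - 1 : ℝ[X]) ^ ℓ).natDegree = ℓ + ℓ := by
    rw [natDegree_pow]
    have : (X ^ 2 - 1 : ℝ[X]).natDegree = 2 := by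
      simpa using natDegree_X_pow_sub_C (n := 2) (r := (1 : ℝ))
    rw [this]; ring
  apply le_antisymm
  · refine (natDegree_C_mul_le _ _).trans ((natDegree_iterate_derivative _ _).trans ?_)
    omega
  · apply le_natDegree_of_ne_zero
    rw [legendreP, coeff_C_mul, coeff_iterate_derivative, ← hd, hm.coeff_natDegree]
    refine mul_ne_zero (by positivity) ?_
    rw [nsmul_one, Nat.cast_ne_zero, Ne, Nat.descFactorial_eq_zero_iff_lt]
    omega

/-- The polynomial form of the derivatives of Legendre's differential equation. -/
lemma legendreP_ode (ℓ m : ℕ) :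
    (1 - X ^ 2) * derivative^[m + 2] (legendreP ℓ) =
      C (2 * ((m : ℝ) + 1)) * X * derivative^[m + 1] (legendreP ℓ) -
        C ((ℓ : ℝ) * (ℓ + 1) - m * (m + 1)) * derivative^[m] (legendreP ℓ) := by
  -- `v = (X² - 1)^ℓ` satisfies a first order equation; differentiate it `n + 1` times
  have key : ∀ n : ℕ, (1 - X ^ 2) * derivative^[n + 2] ((X ^ 2 - 1 : ℝ[X]) ^ ℓ) =
      C (2 * ((n : ℝ) + 1 - ℓ)) * X * derivative^[n + 1] ((X ^ 2 - 1 : ℝ[X]) ^ ℓ) -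
        C (((n : ℝ) + 1) * (2 * ℓ - n)) * derivative^[n] ((X ^ 2 - 1 : ℝ[X]) ^ ℓ) := by
    have h0 : (1 - X ^ 2) * derivative ((X ^ 2 - 1 : ℝ[X]) ^ ℓ) =
        C (-2 * (ℓ : ℝ)) * X * (X ^ 2 - 1 : ℝ[X]) ^ ℓ := by
      rcases ℓ with _ | k
      · simp
      · rw [derivative_pow]
        simp only [derivative_sub, derivative_X_pow, derivative_one, C_mul, C_neg, map_natCast,
          Nat.add_sub_cancel]
        push_cast
        simp only [map_ofNat]
        ring
    intro n
    induction n with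
    | zero =>
      have h1 := congrArg derivative h0
      simp only [derivative_mul, derivative_sub, derivative_one, derivative_X_pow, derivative_C,
        derivative_X] at h1
      simp only [Function.iterate_succ', Function.iterate_zero, Function.comp_apply, id]
      simp only [C_mul, C_add, C_sub, C_neg, map_natCast, map_ofNat, map_one] at h1 ⊢
      push_cast at h1 ⊢
      linear_combination h1
    | succ n ih =>
      have h1 := congrArg derivative ih
      simp only [derivative_mul, derivative_sub, derivative_one, derivative_X_pow, derivative_C,
        derivative_X, ← Function.iterate_succ_apply' derivative] at h1
      simp only [C_mul, C_add, C_sub, map_natCast, map_ofNat, map_one] at h1 ⊢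
      push_cast at h1 ⊢
      linear_combination h1
  -- At order `m + ℓ` the coefficients become `2(m+1)` and `(m+ℓ+1)(ℓ-m) = ℓ(ℓ+1) - m(m+1)`.
  have h := key (m + ℓ)
  have e : ∀ k : ℕ, derivative^[k] (legendreP ℓ) = C ((1 : ℝ) / (2 ^ ℓ * (ℓ.factorial : ℝ))) *
      derivative^[k + ℓ] ((X ^ 2 - 1 : ℝ[X]) ^ ℓ) := by
    intro k
    rw [legendreP, iterate_derivative_C_mul, Function.iterate_add_apply]
  rw [e, e, e, show m + 2 + ℓ = m + ℓ + 2 by ring, show m + 1 + ℓ = m + ℓ + 1 by ring]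
  simp only [C_mul, C_add, C_sub, map_natCast, map_ofNat, map_one] at h ⊢
  push_cast at h ⊢
  linear_combination C ((1 : ℝ) / (2 ^ ℓ * (ℓ.factorial : ℝ))) * h

lemma legendreP_ode_eval (ℓ m : ℕ) (u : ℝ) :
    (1 - u ^ 2) * (derivative^[m + 2] (legendreP ℓ)).eval u =
      2 * ((m : ℝ) + 1) * u * (derivative^[m + 1] (legendreP ℓ)).eval u -
        ((ℓ : ℝ) * (ℓ + 1) - m * (m + 1)) * (derivative^[m] (legendreP ℓ)).eval u := by
  simpa only [eval_mul, eval_sub, eval_one, eval_pow, eval_X, eval_C] using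
    congrArg (eval u) (legendreP_ode ℓ m)

/-- A linear functional on polynomials that behaves like `p ↦ c ∫_{-1}^{1} p`. -/
structure IsFlatFunctional (I : ℝ[X] →ₗ[ℝ] ℝ) : Prop where
  derivative_eq_zero : ∀ q : ℝ[X], I (derivative ((1 - X ^ 2) * q)) = 0

namespace IsFlatFunctional

variable {I : ℝ[X] →ₗ[ℝ] ℝ}

/-- Sturm–Liouville argument: `1 - X²` times the Wronskian of the two polynomials differentiates to
the difference of the eigenvalues times their product. The eigenvalues `ℓ(ℓ+1)` are pairwise
distinct. -/
lemma legendreP_mul_eq_zero (hI : IsFlatFunctional I) {ℓ ℓ' : ℕ} (h : ℓ ≠ ℓ') :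
    I (legendreP ℓ * legendreP ℓ') = 0 := by
  have h1 := legendreP_ode ℓ 0
  have h2 := legendreP_ode ℓ' 0
  have h3 := hI.derivative_eq_zero
    (derivative (legendreP ℓ) * legendreP ℓ' - legendreP ℓ * derivative (legendreP ℓ'))
  have h4 : derivative ((1 - X ^ 2) *
      (derivative (legendreP ℓ) * legendreP ℓ' - legendreP ℓ * derivative (legendreP ℓ'))) =
      ((ℓ' : ℝ) * (ℓ' + 1) - ℓ * (ℓ + 1)) • (legendreP ℓ * legendreP ℓ') := by
    simp only [Function.iterate_succ', Function.iterate_zero, Function.comp_apply, id] at h1 h2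
    rw [smul_eq_C_mul]
    simp only [derivative_mul, derivative_sub, derivative_one, derivative_X_pow]
    simp only [C_mul, C_add, C_sub, map_natCast, map_ofNat, map_one, Nat.cast_zero, map_zero]
      at h1 h2 ⊢
    push_cast at h1 h2 ⊢
    linear_combination legendreP ℓ' * h1 - legendreP ℓ * h2
  rw [h4, map_smul, smul_eq_mul] at h3
  refine (mul_eq_zero.mp h3).resolve_left fun h0 => h ?_
  have h5 : ((ℓ' : ℝ) - ℓ) * (ℓ' + ℓ + 1) = 0 := by linear_combination h0
  rcases mul_eq_zero.mp h5 with h6 | h6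
  · exact_mod_cast (sub_eq_zero.mp h6).symm
  · exfalso
    have : (0 : ℝ) < ℓ' + ℓ + 1 := by positivity
    exact this.ne' h6

/-- There is one Legendre polynomial in each degree, so those of degree below `ℓ` span all
polynomials of degree below `ℓ`. -/
lemma legendreP_mul_eq_zero_of_degree_lt (hI : IsFlatFunctional I) {ℓ : ℕ} {q : ℝ[X]}
    (hq : q.degree < ℓ) : I (legendreP ℓ * q) = 0 := by
  let S : Polynomial.Sequence ℝ :=
    { elems' := legendreP
      degree_eq' := fun i => by
        have hne : legendreP i ≠ 0 := by
          intro h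
          have := legendreP_eval_one i
          simp [h] at this
        rw [degree_eq_natDegree hne, natDegree_legendreP] }
  have hspan := S.span_degreeLT (m := ℓ) (fun i _ => by
    rw [isUnit_iff_ne_zero, Ne, leadingCoeff_eq_zero]; exact S.ne_zero i)
  have hmem : q ∈ Polynomial.degreeLT ℝ ℓ := mem_degreeLT.mpr hq
  rw [← hspan] at hmem
  clear hq
  induction hmem using Submodule.span_induction with
  | mem x hx =>
    obtain ⟨i, hi, rfl⟩ := hx
    exact hI.legendreP_mul_eq_zero (ne_of_gt (by simpa using hi))
  | zero => simp
  | add x y _ _ hx hy => rw [mul_add, map_add, hx, hy, add_zero]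
  | smul r x _ hx => rw [mul_smul_comm, map_smul, hx, smul_zero]

/-- Such an `f` agrees with `X` at both endpoints, hence differs from it by a multiple of `1 - X²`,
whose derivative is annihilated. -/
lemma derivative_eq (hI : IsFlatFunctional I) {f : ℝ[X]} (h1 : f.eval 1 = 1)
    (h2 : f.eval (-1) = -1) : I (derivative f) = I 1 := by
  obtain ⟨q, hq⟩ : (1 - X ^ 2 : ℝ[X]) ∣ f - X := by
    have ha : (X - C 1 : ℝ[X]) ∣ f - X := by rw [dvd_iff_isRoot]; simp [h1]
    have hb : (X - C (-1) : ℝ[X]) ∣ f - X := by rw [dvd_iff_isRoot]; simp [h2]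
    have hcop : IsCoprime (X - C 1 : ℝ[X]) (X - C (-1)) :=
      isCoprime_X_sub_C_of_isUnit_sub (by norm_num)
    obtain ⟨q, hq⟩ := hcop.mul_dvd ha hb
    refine ⟨-q, ?_⟩
    rw [hq]
    simp only [C_neg, C_1]
    ring
  have h3 := hI.derivative_eq_zero q
  rw [← hq, derivative_sub, derivative_X, map_sub] at h3
  linarith

/-- The functional is applied to the derivative of `X P_ℓ²`, which takes the values `±1` at `±1`.
Writing `X P_ℓ' = ℓ P_ℓ + (X P_ℓ' - ℓ P_ℓ)` yields the factor `2ℓ+1` and a remainder orthogonal to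
`P_ℓ`, since its leading term cancels. -/
lemma legendreP_sq (hI : IsFlatFunctional I) (ℓ : ℕ) :
    (2 * (ℓ : ℝ) + 1) * I (legendreP ℓ * legendreP ℓ) = I 1 := by
  have h1 := hI.derivative_eq (f := X * (legendreP ℓ * legendreP ℓ))
    (by simp [legendreP_eval_one])
    (by
      simp only [eval_mul, eval_X, legendreP_eval_of_sq_eq_one (-1) (by norm_num) ℓ, ← pow_add,
        ← two_mul ℓ, pow_mul]
      norm_num)
  have hdeg : (X * derivative (legendreP ℓ) - C (ℓ : ℝ) * legendreP ℓ).degree < (ℓ : WithBot ℕ) := by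
    rw [degree_lt_iff_coeff_zero]
    intro n hn
    have hc : ∀ k, ℓ < k → (legendreP ℓ).coeff k = 0 := fun k hk =>
      coeff_eq_zero_of_natDegree_lt (by rw [natDegree_legendreP]; exact hk)
    rw [coeff_sub, coeff_C_mul]
    rcases n with _ | n
    · have : ℓ = 0 := by simpa using hn
      simp [this]
    · rw [coeff_X_mul, coeff_derivative]
      rcases hn.eq_or_lt with h | h
      · subst h; push_cast; ring
      · rw [hc _ h]; simp
  have h2 := hI.legendreP_mul_eq_zero_of_degree_lt hdeg
  have h3 : derivative (X * (legendreP ℓ * legendreP ℓ)) =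
      (2 * (ℓ : ℝ) + 1) • (legendreP ℓ * legendreP ℓ) +
        (2 : ℝ) • (legendreP ℓ * (X * derivative (legendreP ℓ) - C (ℓ : ℝ) * legendreP ℓ)) := by
    simp only [smul_eq_C_mul, derivative_mul, derivative_X, C_add, C_mul, map_natCast, map_ofNat,
      map_one]
    ring
  rw [h3, map_add, map_smul, map_smul, h2] at h1
  simpa using h1

end IsFlatFunctional

end Legendre

/-! ### Rotations -/

lemma sphere_sq_sum (x : S2) : x.1 0 ^ 2 + x.1 1 ^ 2 + x.1 2 ^ 2 = 1 := by
  have h := x.2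
  rw [mem_sphere_zero_iff_norm, EuclideanSpace.norm_eq, Real.sqrt_eq_one, Fin.sum_univ_three] at h
  simpa using h

lemma dot_eq (x y : S2) : dot x y = x.1 0 * y.1 0 + x.1 1 * y.1 1 + x.1 2 * y.1 2 := by
  simp [dot, PiLp.inner_apply, Fin.sum_univ_three, mul_comm]

lemma dot_comm (x y : S2) : dot x y = dot y x := real_inner_comm _ _

lemma dot_self (x : S2) : dot x x = 1 := by
  rw [dot_eq]; linear_combination sphere_sq_sum x

lemma dot_rotate (ρ : EuclideanSpace ℝ (Fin 3) ≃ₗᵢ[ℝ] EuclideanSpace ℝ (Fin 3)) (x y : S2) :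
    dot (rotate ρ x) (rotate ρ y) = dot x y :=
  ρ.inner_map_map _ _

/-- A determinant one linear isometry. -/
def IsRotation (ρ : EuclideanSpace ℝ (Fin 3) ≃ₗᵢ[ℝ] EuclideanSpace ℝ (Fin 3)) : Prop :=
  LinearMap.det (ρ.toLinearEquiv : EuclideanSpace ℝ (Fin 3) →ₗ[ℝ] EuclideanSpace ℝ (Fin 3)) = 1

/-- The linear isometry with a given orthogonal matrix. -/
def isometryOfMatrix (A : Matrix (Fin 3) (Fin 3) ℝ) (hA : A.transpose * A = 1) :
    EuclideanSpace ℝ (Fin 3) ≃ₗᵢ[ℝ] EuclideanSpace ℝ (Fin 3) :=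
  LinearIsometry.toLinearIsometryEquiv
    { Matrix.toEuclideanLin A with
      norm_map' := fun x => by
        have h : inner ℝ (Matrix.toEuclideanLin A x) (Matrix.toEuclideanLin A x) = inner ℝ x x := by
          rw [← LinearMap.adjoint_inner_right, ← Matrix.toEuclideanLin_conjTranspose_eq_adjoint]
          simp [Matrix.toLpLin_apply, Matrix.conjTranspose_eq_transpose_of_trivial, hA]
        rw [real_inner_self_eq_norm_sq, real_inner_self_eq_norm_sq] at h
        exact (sq_eq_sq₀ (norm_nonneg _) (norm_nonneg _)).mp h } rfl

lemma isometryOfMatrix_apply (A : Matrix (Fin 3) (Fin 3) ℝ) (hA : A.transpose * A = 1)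
    (x : EuclideanSpace ℝ (Fin 3)) (i : Fin 3) :
    isometryOfMatrix A hA x i = A i 0 * x 0 + A i 1 * x 1 + A i 2 * x 2 :=
  Fin.sum_univ_three fun k => A i k * x k

lemma isRotation_isometryOfMatrix (A : Matrix (Fin 3) (Fin 3) ℝ) (hA : A.transpose * A = 1)
    (hdet : A.det = 1) : IsRotation (isometryOfMatrix A hA) := by
  have : ((isometryOfMatrix A hA).toLinearEquiv :
      EuclideanSpace ℝ (Fin 3) →ₗ[ℝ] EuclideanSpace ℝ (Fin 3)) = Matrix.toEuclideanLin A := by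
    ext; rfl
  rw [IsRotation, this, Matrix.toEuclideanLin, Matrix.toLpLin_eq_toLin, LinearMap.det_toLin, hdet]

/-- The rotation by the angle `θ` in the plane of the first two coordinates. -/
def rotXY (θ : ℝ) : EuclideanSpace ℝ (Fin 3) ≃ₗᵢ[ℝ] EuclideanSpace ℝ (Fin 3) :=
  isometryOfMatrix
    !![Real.cos θ, -Real.sin θ, 0; Real.sin θ, Real.cos θ, 0; 0, 0, 1] (by
      have h := Real.sin_sq_add_cos_sq θ
      ext i j
      fin_cases i <;> fin_cases j <;> simp [Matrix.mul_apply, Fin.sum_univ_three] <;>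
        first | linear_combination h | ring)

/-- The rotation by the angle `θ` in the plane of the first and the last coordinates. -/
def rotXZ (θ : ℝ) : EuclideanSpace ℝ (Fin 3) ≃ₗᵢ[ℝ] EuclideanSpace ℝ (Fin 3) :=
  isometryOfMatrix
    !![Real.cos θ, 0, -Real.sin θ; 0, 1, 0; Real.sin θ, 0, Real.cos θ] (by
      have h := Real.sin_sq_add_cos_sq θ
      ext i j
      fin_cases i <;> fin_cases j <;> simp [Matrix.mul_apply, Fin.sum_univ_three] <;>
        first | linear_combination h | ring)

lemma isRotation_rotXY (θ : ℝ) : IsRotation (rotXY θ) := by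
  apply isRotation_isometryOfMatrix
  simp [Matrix.det_fin_three]
  linear_combination Real.sin_sq_add_cos_sq θ

lemma isRotation_rotXZ (θ : ℝ) : IsRotation (rotXZ θ) := by
  apply isRotation_isometryOfMatrix
  simp [Matrix.det_fin_three]
  linear_combination Real.sin_sq_add_cos_sq θ

lemma rotate_rotXY_zero (θ : ℝ) (x : S2) :
    (rotate (rotXY θ) x).1 0 = x.1 0 * Real.cos θ - x.1 1 * Real.sin θ := by
  refine (isometryOfMatrix_apply _ _ _ _).trans ?_
  simp; ring

lemma rotate_rotXY_one (θ : ℝ) (x : S2) :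
    (rotate (rotXY θ) x).1 1 = x.1 0 * Real.sin θ + x.1 1 * Real.cos θ := by
  refine (isometryOfMatrix_apply _ _ _ _).trans ?_
  simp; ring

lemma rotate_rotXY_two (θ : ℝ) (x : S2) : (rotate (rotXY θ) x).1 2 = x.1 2 := by
  refine (isometryOfMatrix_apply _ _ _ _).trans ?_
  simp

lemma rotate_rotXZ_zero (θ : ℝ) (x : S2) :
    (rotate (rotXZ θ) x).1 0 = x.1 0 * Real.cos θ - x.1 2 * Real.sin θ := by
  refine (isometryOfMatrix_apply _ _ _ _).trans ?_
  simp; ring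

lemma rotate_rotXZ_one (θ : ℝ) (x : S2) : (rotate (rotXZ θ) x).1 1 = x.1 1 := by
  refine (isometryOfMatrix_apply _ _ _ _).trans ?_
  simp

lemma rotate_rotXZ_two (θ : ℝ) (x : S2) :
    (rotate (rotXZ θ) x).1 2 = x.1 0 * Real.sin θ + x.1 2 * Real.cos θ := by
  refine (isometryOfMatrix_apply _ _ _ _).trans ?_
  simp; ring

/-- The point `(0, 0, 1)` of the sphere. -/
def northPole : S2 := ⟨EuclideanSpace.single 2 1, by simp⟩

lemma northPole_zero : northPole.1 0 = 0 := by simp [northPole]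
lemma northPole_one : northPole.1 1 = 0 := by simp [northPole]
lemma northPole_two : northPole.1 2 = 1 := by simp [northPole]

lemma dot_northPole (x : S2) : dot x northPole = x.1 2 := by
  simp [dot_eq, northPole_zero, northPole_one, northPole_two]

/-- The angle is minus the argument of `u + iv`: rotating by it sends `(u, v)` to the positive
half-axis. -/
lemma exists_angle (u v : ℝ) : ∃ θ : ℝ, u * Real.sin θ + v * Real.cos θ = 0 ∧
    u * Real.cos θ - v * Real.sin θ = Real.sqrt (u ^ 2 + v ^ 2) := by
  let z : ℂ := ⟨u, v⟩
  have h1 : ‖z‖ * Real.cos z.arg = u := Complex.norm_mul_cos_arg z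
  have h2 : ‖z‖ * Real.sin z.arg = v := Complex.norm_mul_sin_arg z
  have h3 : ‖z‖ = Real.sqrt (u ^ 2 + v ^ 2) := by
    rw [Complex.norm_def, Complex.normSq_mk]; congr 1; ring
  refine ⟨-z.arg, ?_, ?_⟩
  · rw [Real.sin_neg, Real.cos_neg, ← h1, ← h2]; ring
  · rw [Real.sin_neg, Real.cos_neg, ← h3, ← h1, ← h2]
    linear_combination ‖z‖ * Real.sin_sq_add_cos_sq z.arg

lemma exists_rotXZ_rotXY_eq_northPole (y : S2) :
    ∃ θ φ : ℝ, rotate (rotXZ φ) (rotate (rotXY θ) y) = northPole := by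
  obtain ⟨θ, hθ, -⟩ := exists_angle (y.1 0) (y.1 1)
  set y' := rotate (rotXY θ) y with hy'
  have h1 : y'.1 1 = 0 := by rw [hy', rotate_rotXY_one, hθ]
  obtain ⟨φ, hφ, hφ'⟩ := exists_angle (y'.1 2) (-y'.1 0)
  -- With its second coordinate zero, the point lies on the unit circle of the remaining plane, so
  -- the length produced by the second rotation is `1`.
  have h2 : (-y'.1 0) ^ 2 = 1 - y'.1 2 ^ 2 := by
    have := sphere_sq_sum y'
    rw [h1] at this
    linear_combination this
  rw [h2, add_sub_cancel, Real.sqrt_one] at hφ'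
  refine ⟨θ, φ, ?_⟩
  apply Subtype.ext
  ext i
  fin_cases i
  · simp only [Fin.zero_eta]
    rw [northPole_zero, rotate_rotXZ_zero]; linear_combination -hφ
  · simp only [Fin.mk_one]
    rw [northPole_one, rotate_rotXZ_one, h1]
  · simp only [Fin.reduceFinMk]
    rw [northPole_two, rotate_rotXZ_two]; linear_combination hφ'

/-- Rotations act transitively on the sphere. -/
lemma eq_northPole_of_rotation_invariant {β : Type*} (f : S2 → β)
    (hf : ∀ ρ, IsRotation ρ → ∀ x, f (rotate ρ x) = f x) (x : S2) : f x = f northPole := by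
  obtain ⟨θ, φ, h⟩ := exists_rotXZ_rotXY_eq_northPole x
  rw [← h, hf _ (isRotation_rotXZ φ), hf _ (isRotation_rotXY θ)]

/-! ### The addition theorem -/

/-- The unnormalized spherical harmonic of degree `ℓ` and order `m ≥ 0`. -/
def rawHarmonic (ℓ m : ℕ) (x : S2) : ℂ :=
  ((x.1 0 : ℂ) + Complex.I * (x.1 1 : ℂ)) ^ m *
    (((Polynomial.derivative^[m] (legendreP ℓ)).eval (x.1 2) : ℝ) : ℂ)

lemma rawHarmonic_eq_zero {ℓ m : ℕ} (h : ℓ < m) (x : S2) : rawHarmonic ℓ m x = 0 := by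
  rw [rawHarmonic, Polynomial.iterate_derivative_eq_zero (by rwa [natDegree_legendreP])]
  simp

/-- The derivative of an unnormalized spherical harmonic along the rotations `rotXZ`. -/
def rawHarmonicDeriv (ℓ m : ℕ) (x : S2) : ℂ :=
  -((m : ℂ) * (x.1 2 : ℂ) * ((x.1 0 : ℂ) + Complex.I * (x.1 1 : ℂ)) ^ (m - 1) *
    (((Polynomial.derivative^[m] (legendreP ℓ)).eval (x.1 2) : ℝ) : ℂ)) +
  (x.1 0 : ℂ) * ((x.1 0 : ℂ) + Complex.I * (x.1 1 : ℂ)) ^ m *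
    (((Polynomial.derivative^[m + 1] (legendreP ℓ)).eval (x.1 2) : ℝ) : ℂ)

lemma hasDerivAt_rawHarmonic (ℓ m : ℕ) (x : S2) (θ : ℝ) :
    HasDerivAt (fun t => rawHarmonic ℓ m (rotate (rotXZ t) x))
      (rawHarmonicDeriv ℓ m (rotate (rotXZ θ) x)) θ := by
  have h0 : HasDerivAt (fun t => (rotate (rotXZ t) x).1 0) (-(rotate (rotXZ θ) x).1 2) θ := by
    simp only [rotate_rotXZ_zero, rotate_rotXZ_two]
    refine (((Real.hasDerivAt_cos θ).const_mul (x.1 0)).sub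
      ((Real.hasDerivAt_sin θ).const_mul (x.1 2))).congr_deriv ?_
    ring
  have h2 : HasDerivAt (fun t => (rotate (rotXZ t) x).1 2) ((rotate (rotXZ θ) x).1 0) θ := by
    simp only [rotate_rotXZ_zero, rotate_rotXZ_two]
    refine (((Real.hasDerivAt_sin θ).const_mul (x.1 0)).add
      ((Real.hasDerivAt_cos θ).const_mul (x.1 2))).congr_deriv ?_
    ring
  have h3 := ((Polynomial.derivative^[m] (legendreP ℓ)).hasDerivAt
    ((rotate (rotXZ θ) x).1 2)).comp θ h2
  have h4 := ((h0.ofReal_comp.add_const (Complex.I * (x.1 1 : ℂ))).pow m).mul h3.ofReal_comp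
  simp only [rawHarmonic, rawHarmonicDeriv, rotate_rotXZ_one]
  refine h4.congr_deriv ?_
  simp only [Function.comp_apply, Function.iterate_succ', Pi.pow_apply]
  push_cast
  ring

lemma rawHarmonicDeriv_zero (ℓ : ℕ) (x : S2) :
    rawHarmonicDeriv ℓ 0 x = ((rawHarmonic ℓ 1 x).re : ℂ) := by
  simp [rawHarmonicDeriv, rawHarmonic]

/-- The ladder relation. -/
lemma rawHarmonicDeriv_succ (ℓ m : ℕ) (x : S2) :
    rawHarmonicDeriv ℓ (m + 1) x = (1 / 2) * rawHarmonic ℓ (m + 2) x -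
      (1 / 2) * (((ℓ : ℂ) - m) * (ℓ + m + 1)) * rawHarmonic ℓ m x := by
  have h1 := congrArg (fun r : ℝ => (r : ℂ)) (legendreP_ode_eval ℓ m (x.1 2))
  have h2 := congrArg (fun r : ℝ => (r : ℂ)) (sphere_sq_sum x)
  have hI := Complex.I_sq
  simp only [rawHarmonicDeriv, rawHarmonic, Nat.add_sub_cancel, add_assoc, Nat.reduceAdd]
  push_cast at h1 h2 ⊢
  set w := (x.1 0 : ℂ) + Complex.I * (x.1 1 : ℂ) with hw
  set p0 := (((Polynomial.derivative^[m] (legendreP ℓ)).eval (x.1 2) : ℝ) : ℂ)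
  set p1 := (((Polynomial.derivative^[m + 1] (legendreP ℓ)).eval (x.1 2) : ℝ) : ℂ)
  set p2 := (((Polynomial.derivative^[m + 2] (legendreP ℓ)).eval (x.1 2) : ℝ) : ℂ)
  have h3 : w * ((x.1 0 : ℂ) - Complex.I * (x.1 1 : ℂ)) = 1 - (x.1 2 : ℂ) ^ 2 := by
    rw [hw]; linear_combination h2 - (x.1 1 : ℂ) ^ 2 * hI
  -- Since `x₀` is the mean of `w` and its conjugate, multiplication by it gives one raising term
  -- and one term carrying the factor `1 - x₂²`, to which Legendre's equation applies.
  have h4 : (x.1 0 : ℂ) * w = (1 / 2) * w ^ 2 + (1 / 2) * (1 - (x.1 2 : ℂ) ^ 2) := by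
    rw [← h3, hw]; ring
  rw [pow_succ w m, show w ^ (m + 2) = w ^ m * w ^ 2 by ring]
  linear_combination w ^ m * p2 * h4 + (1 / 2) * w ^ m * h1

/-- The ratio of factorials in the normalization of spherical harmonics. -/
def harmonicWeight (ℓ m : ℕ) : ℝ := ((ℓ - m).factorial : ℝ) / ((ℓ + m).factorial : ℝ)

lemma harmonicWeight_zero (ℓ : ℕ) : harmonicWeight ℓ 0 = 1 := by
  simp only [harmonicWeight, Nat.sub_zero, Nat.add_zero]
  exact div_self (by positivity)

/-- The lowering coefficient of the ladder relation is exactly the ratio of consecutive weights.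
This is what makes the sum over orders telescope. -/
lemma harmonicWeight_succ {ℓ m : ℕ} (h : m < ℓ) :
    harmonicWeight ℓ (m + 1) * (((ℓ : ℝ) - m) * (ℓ + m + 1)) = harmonicWeight ℓ m := by
  obtain ⟨k, rfl⟩ := Nat.exists_eq_add_of_lt h
  have e1 : m + k + 1 - m = k + 1 := by omega
  have e2 : m + k + 1 - (m + 1) = k := by omega
  have e3 : m + k + 1 + (m + 1) = (m + k + 1 + m) + 1 := by ring
  rw [harmonicWeight, harmonicWeight, e1, e2, e3, Nat.factorial_succ k, Nat.factorial_succ]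
  push_cast
  have : ((m + k + 1 + m).factorial : ℝ) ≠ 0 := by positivity
  have : ((m : ℝ) + k + 1 + m + 1) ≠ 0 := by positivity
  field_simp
  ring

/-- The sum of products of spherical harmonics in the addition theorem, up to a factor. -/
def harmonicKernel (ℓ : ℕ) (x y : S2) : ℝ :=
  (rawHarmonic ℓ 0 x * (starRingEnd ℂ) (rawHarmonic ℓ 0 y) +
    ∑ m ∈ Finset.range ℓ, ((2 * harmonicWeight ℓ (m + 1) : ℝ) : ℂ) *
      (rawHarmonic ℓ (m + 1) x * (starRingEnd ℂ) (rawHarmonic ℓ (m + 1) y))).re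

/-- The sum telescopes by the ladder relation and the recurrence of the weights. At `n = ℓ` the
upper boundary term vanishes, because harmonics of order `ℓ + 1` do, and the real part of the lower
one cancels the derivative of the order zero term. -/
lemma sum_rawHarmonicDeriv (ℓ : ℕ) (x y : S2) (n : ℕ) (hn : n ≤ ℓ) :
    ∑ m ∈ Finset.range n, ((2 * harmonicWeight ℓ (m + 1) : ℝ) : ℂ) *
      (rawHarmonicDeriv ℓ (m + 1) x * (starRingEnd ℂ) (rawHarmonic ℓ (m + 1) y) +
        rawHarmonic ℓ (m + 1) x * (starRingEnd ℂ) (rawHarmonicDeriv ℓ (m + 1) y)) =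
    (harmonicWeight ℓ n : ℂ) * (rawHarmonic ℓ (n + 1) x * (starRingEnd ℂ) (rawHarmonic ℓ n y) +
      rawHarmonic ℓ n x * (starRingEnd ℂ) (rawHarmonic ℓ (n + 1) y)) -
    (rawHarmonic ℓ 1 x * (starRingEnd ℂ) (rawHarmonic ℓ 0 y) +
      rawHarmonic ℓ 0 x * (starRingEnd ℂ) (rawHarmonic ℓ 1 y)) := by
  induction n with
  | zero => simp [harmonicWeight_zero]
  | succ n ih =>
    rw [Finset.sum_range_succ, ih (by omega), rawHarmonicDeriv_succ, rawHarmonicDeriv_succ]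
    have h := congrArg (fun r : ℝ => (r : ℂ)) (harmonicWeight_succ (ℓ := ℓ) (m := n) (by omega))
    push_cast at h ⊢
    rw [← h]
    simp only [map_sub, map_mul, map_add, map_div₀, map_one, map_ofNat, Complex.conj_natCast]
    ring

lemma harmonicKernel_rotXZ (ℓ : ℕ) (x y : S2) (θ : ℝ) :
    harmonicKernel ℓ (rotate (rotXZ θ) x) (rotate (rotXZ θ) y) =
      harmonicKernel ℓ (rotate (rotXZ 0) x) (rotate (rotXZ 0) y) := by
  have hprod : ∀ (m : ℕ) (t : ℝ), HasDerivAt (fun t => rawHarmonic ℓ m (rotate (rotXZ t) x) *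
      (starRingEnd ℂ) (rawHarmonic ℓ m (rotate (rotXZ t) y)))
      (rawHarmonicDeriv ℓ m (rotate (rotXZ t) x) *
        (starRingEnd ℂ) (rawHarmonic ℓ m (rotate (rotXZ t) y)) +
      rawHarmonic ℓ m (rotate (rotXZ t) x) *
        (starRingEnd ℂ) (rawHarmonicDeriv ℓ m (rotate (rotXZ t) y))) t := fun m t =>
    (hasDerivAt_rawHarmonic ℓ m x t).mul
      (Complex.conjCLE.toContinuousLinearMap.hasFDerivAt.comp_hasDerivAt t
        (hasDerivAt_rawHarmonic ℓ m y t))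
  have hder : ∀ t, HasDerivAt
      (fun t => harmonicKernel ℓ (rotate (rotXZ t) x) (rotate (rotXZ t) y)) 0 t := by
    intro t
    have h1 := (hprod 0 t).add (HasDerivAt.fun_sum (u := Finset.range ℓ) fun m _ =>
      (hprod (m + 1) t).const_mul ((2 * harmonicWeight ℓ (m + 1) : ℝ) : ℂ))
    have h2 := Complex.reCLM.hasFDerivAt.comp_hasDerivAt t h1
    refine HasDerivAt.congr_deriv (f := fun t =>
      harmonicKernel ℓ (rotate (rotXZ t) x) (rotate (rotXZ t) y)) h2 ?_
    rw [sum_rawHarmonicDeriv ℓ _ _ ℓ le_rfl, rawHarmonic_eq_zero (Nat.lt_succ_self ℓ),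
      rawHarmonic_eq_zero (Nat.lt_succ_self ℓ), rawHarmonicDeriv_zero, rawHarmonicDeriv_zero]
    have him : ∀ z, (rawHarmonic ℓ 0 z).im = 0 := fun z => by simp [rawHarmonic]
    simp [him]
  exact is_const_of_deriv_eq_zero (fun t => (hder t).differentiableAt) (fun t => (hder t).deriv) θ 0

lemma rotate_rotXZ_zero_angle (x : S2) : rotate (rotXZ 0) x = x := by
  apply Subtype.ext
  ext i
  fin_cases i
  · simpa using rotate_rotXZ_zero 0 x
  · simpa using rotate_rotXZ_one 0 x
  · simpa using rotate_rotXZ_two 0 x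

lemma rawHarmonic_rotXY (ℓ m : ℕ) (x : S2) (θ : ℝ) :
    rawHarmonic ℓ m (rotate (rotXY θ) x) = Complex.exp (θ * Complex.I) ^ m * rawHarmonic ℓ m x := by
  rw [rawHarmonic, rawHarmonic, ← mul_assoc, ← mul_pow, rotate_rotXY_zero, rotate_rotXY_one,
    rotate_rotXY_two, Complex.exp_mul_I]
  congr 2
  push_cast
  linear_combination -(x.1 1 : ℂ) * Complex.sin θ * Complex.I_sq

lemma harmonicKernel_rotXY (ℓ : ℕ) (x y : S2) (θ : ℝ) :
    harmonicKernel ℓ (rotate (rotXY θ) x) (rotate (rotXY θ) y) = harmonicKernel ℓ x y := by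
  have h : ∀ m, rawHarmonic ℓ m (rotate (rotXY θ) x) *
      (starRingEnd ℂ) (rawHarmonic ℓ m (rotate (rotXY θ) y)) =
      rawHarmonic ℓ m x * (starRingEnd ℂ) (rawHarmonic ℓ m y) := by
    intro m
    have he : Complex.exp (θ * Complex.I) * (starRingEnd ℂ) (Complex.exp (θ * Complex.I)) = 1 := by
      rw [Complex.mul_conj, Complex.normSq_eq_norm_sq, Complex.norm_exp_ofReal_mul_I]
      simp
    rw [rawHarmonic_rotXY, rawHarmonic_rotXY, map_mul, map_pow, mul_mul_mul_comm, ← mul_pow, he,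
      one_pow, one_mul]
  simp only [harmonicKernel, h]

lemma harmonicKernel_northPole (ℓ : ℕ) (x : S2) :
    harmonicKernel ℓ x northPole = (legendreP ℓ).eval (x.1 2) := by
  have h0 : ∀ m, rawHarmonic ℓ (m + 1) northPole = 0 := by
    intro m
    simp [rawHarmonic, northPole_zero, northPole_one]
  simp only [harmonicKernel, h0, map_zero, mul_zero, Finset.sum_const_zero, add_zero]
  simp [rawHarmonic, northPole_two, legendreP_eval_one]

/-- Both sides are unchanged when `rotXY` or `rotXZ` acts on the two points simultaneously, so `y`
may be moved to the pole, where only the order zero term survives. -/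
lemma harmonicKernel_eq (ℓ : ℕ) (x y : S2) :
    harmonicKernel ℓ x y = (legendreP ℓ).eval (dot x y) := by
  obtain ⟨θ, φ, h⟩ := exists_rotXZ_rotXY_eq_northPole y
  rw [← harmonicKernel_rotXY ℓ x y θ, ← dot_rotate (rotXY θ), ← dot_rotate (rotXZ φ), h,
    dot_northPole, ← harmonicKernel_northPole, ← h, harmonicKernel_rotXZ, rotate_rotXZ_zero_angle,
    rotate_rotXZ_zero_angle]

lemma sphericalHarmonic_natCast (ℓ m : ℕ) (x : S2) : sphericalHarmonic ℓ m x =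
    (Real.sqrt ((2 * (ℓ : ℝ) + 1) / (4 * Real.pi) * harmonicWeight ℓ m) : ℂ) *
      rawHarmonic ℓ m x := by
  simp [sphericalHarmonic, rawHarmonic, harmonicWeight, mul_assoc]

lemma sphericalHarmonic_neg_natCast (ℓ m : ℕ) (x : S2) : sphericalHarmonic ℓ (-(m : ℤ)) x =
    (starRingEnd ℂ) (sphericalHarmonic ℓ m x) := by
  rcases m with _ | m
  · simp [sphericalHarmonic]
  · have h1 : ¬ (0 ≤ -((m + 1 : ℕ) : ℤ)) := by omega
    have h2 : 0 ≤ ((m + 1 : ℕ) : ℤ) := by omega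
    simp only [sphericalHarmonic, Int.natAbs_neg, Int.natAbs_natCast, if_neg h1, if_pos h2, map_mul,
      map_pow, map_add, Complex.conj_ofReal, Complex.conj_I]

lemma sum_Icc_neg_natCast {β : Type*} [AddCommMonoid β] (F : ℤ → β) (ℓ : ℕ) :
    ∑ m ∈ Finset.Icc (-(ℓ : ℤ)) ℓ, F m =
      F 0 + ∑ m ∈ Finset.range ℓ, (F ((m + 1 : ℕ) : ℤ) + F (-((m + 1 : ℕ) : ℤ))) := by
  induction ℓ with
  | zero => simp
  | succ n ih =>
    have h : Finset.Icc (-((n + 1 : ℕ) : ℤ)) ((n + 1 : ℕ) : ℤ) =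
        insert (((n + 1 : ℕ) : ℤ)) (insert (-((n + 1 : ℕ) : ℤ)) (Finset.Icc (-(n : ℤ)) n)) := by
      ext k
      simp only [Finset.mem_Icc, Finset.mem_insert]
      push_cast
      omega
    rw [h, Finset.sum_insert, Finset.sum_insert, ih, Finset.sum_range_succ]
    · abel
    · simp only [Finset.mem_Icc]; push_cast; omega
    · simp only [Finset.mem_Icc, Finset.mem_insert]; push_cast; omega

/-- The addition theorem for spherical harmonics. -/
theorem sum_sphericalHarmonic_mul_conj (ℓ : ℕ) (x y : S2) :
    ∑ m ∈ Finset.Icc (-(ℓ : ℤ)) ℓ,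
      sphericalHarmonic ℓ m x * (starRingEnd ℂ) (sphericalHarmonic ℓ m y) =
      (legendreL ℓ (dot x y) : ℂ) := by
  set K : ℝ := (2 * (ℓ : ℝ) + 1) / (4 * Real.pi) with hK
  have hK0 : 0 ≤ K := by positivity
  have hsq : ∀ m : ℕ, (Real.sqrt (K * harmonicWeight ℓ m) : ℂ) *
      (Real.sqrt (K * harmonicWeight ℓ m) : ℂ) = ((K * harmonicWeight ℓ m : ℝ) : ℂ) := by
    intro m
    rw [← Complex.ofReal_mul, Real.mul_self_sqrt]
    exact mul_nonneg hK0 (by unfold harmonicWeight; positivity)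
  have hterm : ∀ m : ℕ, sphericalHarmonic ℓ m x * (starRingEnd ℂ) (sphericalHarmonic ℓ m y) =
      ((K * harmonicWeight ℓ m : ℝ) : ℂ) *
        (rawHarmonic ℓ m x * (starRingEnd ℂ) (rawHarmonic ℓ m y)) := by
    intro m
    rw [sphericalHarmonic_natCast, sphericalHarmonic_natCast, map_mul, Complex.conj_ofReal, ← hsq]
    ring
  have hzero : (rawHarmonic ℓ 0 x * (starRingEnd ℂ) (rawHarmonic ℓ 0 y)) =
      ((rawHarmonic ℓ 0 x * (starRingEnd ℂ) (rawHarmonic ℓ 0 y)).re : ℂ) := by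
    simp [rawHarmonic]
  -- The terms of order `m` and `-m` are conjugate, so they add up to twice a real part. This is the
  -- origin of the factor 2 in `harmonicKernel`.
  have hpair : ∀ m : ℕ, sphericalHarmonic ℓ m x * (starRingEnd ℂ) (sphericalHarmonic ℓ m y) +
      sphericalHarmonic ℓ (-(m : ℤ)) x * (starRingEnd ℂ) (sphericalHarmonic ℓ (-(m : ℤ)) y) =
      ((K * (2 * harmonicWeight ℓ m *
        (rawHarmonic ℓ m x * (starRingEnd ℂ) (rawHarmonic ℓ m y)).re) : ℝ) : ℂ) := by
    intro m
    rw [sphericalHarmonic_neg_natCast, sphericalHarmonic_neg_natCast, ← map_mul, Complex.add_conj,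
      hterm, Complex.re_ofReal_mul]
    push_cast
    ring
  rw [sum_Icc_neg_natCast, legendreL, ← harmonicKernel_eq, ← hK]
  simp only [hpair]
  have h0 := hterm 0
  rw [hzero, harmonicWeight_zero, mul_one] at h0
  rw [Nat.cast_zero] at h0
  rw [h0, harmonicKernel, ← Complex.ofReal_sum, ← Complex.ofReal_mul, ← Complex.ofReal_add,
    Complex.add_re, Complex.re_sum, mul_add, Finset.mul_sum]
  simp only [Complex.re_ofReal_mul]

/-! ### The surface measure -/

instance : IsFiniteMeasure sphereMeasure := by unfold sphereMeasure; infer_instance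

lemma sphereMeasure_real_univ : sphereMeasure.real Set.univ = 4 * Real.pi := by
  rw [sphereMeasure, Measure.toSphere_real_apply_univ, measureReal_def,
    EuclideanSpace.volume_ball_fin_three]
  rw [ENNReal.ofReal_one, one_pow, one_mul, ENNReal.toReal_ofReal (by positivity)]
  simp
  ring

lemma integrable_of_continuous {E : Type*} [NormedAddCommGroup E] {f : S2 → E}
    (hf : Continuous f) : Integrable f sphereMeasure :=
  hf.integrable_of_hasCompactSupport (HasCompactSupport.of_compactSpace f)

lemma continuous_rotate (ρ : EuclideanSpace ℝ (Fin 3) ≃ₗᵢ[ℝ] EuclideanSpace ℝ (Fin 3)) :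
    Continuous (rotate ρ) :=
  (ρ.continuous.comp continuous_subtype_val).subtype_mk _

open scoped Pointwise in
lemma measurePreserving_rotate (ρ : EuclideanSpace ℝ (Fin 3) ≃ₗᵢ[ℝ] EuclideanSpace ℝ (Fin 3)) :
    MeasurePreserving (rotate ρ) sphereMeasure sphereMeasure := by
  refine ⟨(continuous_rotate ρ).measurable, ?_⟩
  ext s hs
  have hm := (continuous_rotate ρ).measurable hs
  rw [Measure.map_apply (continuous_rotate ρ).measurable hs, sphereMeasure,
    Measure.toSphere_apply' _ hm, Measure.toSphere_apply' _ hs]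
  congr 1
  -- The surface measure of a set is a multiple of the volume of the cone over it, and cones commute
  -- with linear isometries. Invariance thus reduces to that of Lebesgue measure.
  have hset : Set.Ioo (0 : ℝ) 1 • ((↑) '' (rotate ρ ⁻¹' s) : Set (EuclideanSpace ℝ (Fin 3))) =
      ρ ⁻¹' (Set.Ioo (0 : ℝ) 1 • ((↑) '' s)) := by
    ext v
    simp only [Set.mem_smul, Set.mem_image, Set.mem_preimage]
    constructor
    · rintro ⟨r, hr, _, ⟨x, hx, rfl⟩, rfl⟩
      exact ⟨r, hr, _, ⟨rotate ρ x, hx, rfl⟩, by simp [rotate]⟩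
    · rintro ⟨r, hr, _, ⟨x, hx, rfl⟩, h⟩
      refine ⟨r, hr, _, ⟨rotate ρ.symm x, ?_, rfl⟩, ?_⟩
      · have : rotate ρ (rotate ρ.symm x) = x := by
          apply Subtype.ext
          simp [rotate]
        rwa [this]
      · apply ρ.injective
        rw [← h]
        simp [rotate]
  rw [hset]
  exact ρ.measurePreserving.measure_preimage_equiv (f := ρ.toMeasurableEquiv) _

lemma integral_comp_rotate {E : Type*} [NormedAddCommGroup E] [NormedSpace ℝ E]
    (ρ : EuclideanSpace ℝ (Fin 3) ≃ₗᵢ[ℝ] EuclideanSpace ℝ (Fin 3)) {f : S2 → E}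
    (hf : AEStronglyMeasurable f sphereMeasure) :
    ∫ x, f (rotate ρ x) ∂sphereMeasure = ∫ x, f x ∂sphereMeasure := by
  have h := (measurePreserving_rotate ρ).map_eq
  conv_rhs => rw [← h]
  rw [integral_map (continuous_rotate ρ).aemeasurable (by rwa [h])]

lemma continuous_coord (i : Fin 3) : Continuous fun x : S2 => x.1 i := by fun_prop

lemma continuous_dot : Continuous fun z : S2 × S2 => dot z.1 z.2 := by
  simp only [dot_eq]; fun_prop

lemma continuous_dot_left (y : S2) : Continuous fun x : S2 => dot x y := by
  simp only [dot_eq]; fun_prop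

lemma continuous_dot_right (x : S2) : Continuous fun y : S2 => dot x y := by
  simp only [dot_eq]; fun_prop

/-! ### Orthogonality of Legendre polynomials on the sphere -/

open Polynomial in
/-- Integration over the sphere of polynomials in the last coordinate. -/
def axisIntegral : ℝ[X] →ₗ[ℝ] ℝ where
  toFun p := ∫ x, p.eval (x.1 2) ∂sphereMeasure
  map_add' p q := by
    simp only [eval_add]
    exact integral_add (integrable_of_continuous (p.continuous.comp (continuous_coord 2)))
      (integrable_of_continuous (q.continuous.comp (continuous_coord 2)))
  map_smul' r p := by
    simp only [eval_smul, integral_smul, RingHom.id_apply]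

lemma axisIntegral_apply (p : Polynomial ℝ) :
    axisIntegral p = ∫ x, p.eval (x.1 2) ∂sphereMeasure := rfl

lemma axisIntegral_one : axisIntegral 1 = 4 * Real.pi := by
  simp [axisIntegral_apply, sphereMeasure_real_univ]

/-- Rotation invariance, differentiated. -/
lemma integral_coord_mul_eq (q : Polynomial ℝ) :
    ∫ x : S2, (x.1 0 ^ 2 * q.derivative.eval (x.1 2) - x.1 2 * q.eval (x.1 2)) ∂sphereMeasure
      = 0 := by
  set f : S2 → ℝ := fun x => x.1 0 * q.eval (x.1 2) with hf
  set h : S2 → ℝ := fun x => x.1 0 ^ 2 * q.derivative.eval (x.1 2) - x.1 2 * q.eval (x.1 2) with hh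
  have hfc : Continuous f := (continuous_coord 0).mul (q.continuous.comp (continuous_coord 2))
  have hhc : Continuous h :=
    (((continuous_coord 0).pow 2).mul (q.derivative.continuous.comp (continuous_coord 2))).sub
      ((continuous_coord 2).mul (q.continuous.comp (continuous_coord 2)))
  obtain ⟨C, hC⟩ := isCompact_univ.exists_bound_of_continuousOn hhc.continuousOn
  have hd : ∀ (x : S2) (t : ℝ), HasDerivAt (fun t => f (rotate (rotXZ t) x))
      (h (rotate (rotXZ t) x)) t := by
    intro x t
    have h0 : HasDerivAt (fun t => (rotate (rotXZ t) x).1 0) (-(rotate (rotXZ t) x).1 2) t := by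
      simp only [rotate_rotXZ_zero, rotate_rotXZ_two]
      refine (((Real.hasDerivAt_cos t).const_mul (x.1 0)).sub
        ((Real.hasDerivAt_sin t).const_mul (x.1 2))).congr_deriv ?_
      ring
    have h2 : HasDerivAt (fun t => (rotate (rotXZ t) x).1 2) ((rotate (rotXZ t) x).1 0) t := by
      simp only [rotate_rotXZ_zero, rotate_rotXZ_two]
      refine (((Real.hasDerivAt_sin t).const_mul (x.1 0)).add
        ((Real.hasDerivAt_cos t).const_mul (x.1 2))).congr_deriv ?_
      ring
    have h3 := h0.mul ((q.hasDerivAt ((rotate (rotXZ t) x).1 2)).comp t h2)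
    refine h3.congr_deriv ?_
    simp only [Function.comp_apply, hh]
    ring
  have key := hasDerivAt_integral_of_dominated_loc_of_deriv_le (μ := sphereMeasure)
    (F := fun (t : ℝ) (x : S2) => f (rotate (rotXZ t) x))
    (F' := fun t x => h (rotate (rotXZ t) x)) (x₀ := 0) (s := Set.univ) (bound := fun _ => C)
    Filter.univ_mem
    (Filter.Eventually.of_forall fun t => (hfc.comp (continuous_rotate _)).aestronglyMeasurable)
    (integrable_of_continuous (hfc.comp (continuous_rotate _)))
    (hhc.comp (continuous_rotate _)).aestronglyMeasurable
    (Filter.Eventually.of_forall fun x t _ => hC _ (Set.mem_univ _))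
    (integrable_const _)
    (Filter.Eventually.of_forall fun x t _ => hd x t)
  have h1 := key.2
  -- By invariance the integral of the rotated `f` is constant in the angle, so its derivative, the
  -- integral of `h`, is zero.
  simp only [integral_comp_rotate _ hfc.aestronglyMeasurable,
    integral_comp_rotate _ hhc.aestronglyMeasurable] at h1
  exact h1.unique (hasDerivAt_const _ _)

/-- On the sphere `1 - x₂² = x₀² + x₁²`, so the derivative of `(1 - X²) q` is the sum of the
integrand of `integral_coord_mul_eq` and its analogue with `x₁` for `x₀`; a quarter turn exchanges
the two. -/
lemma isFlatFunctional_axisIntegral : IsFlatFunctional axisIntegral := by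
  refine ⟨fun q => ?_⟩
  have c0 : Continuous fun x : S2 => x.1 0 ^ 2 * q.derivative.eval (x.1 2) :=
    ((continuous_coord 0).pow 2).mul (q.derivative.continuous.comp (continuous_coord 2))
  have c1 : Continuous fun x : S2 => x.1 1 ^ 2 * q.derivative.eval (x.1 2) :=
    ((continuous_coord 1).pow 2).mul (q.derivative.continuous.comp (continuous_coord 2))
  have c2 : Continuous fun x : S2 => x.1 2 * q.eval (x.1 2) :=
    (continuous_coord 2).mul (q.continuous.comp (continuous_coord 2))
  have h0 := integral_coord_mul_eq q
  rw [integral_sub (integrable_of_continuous c0) (integrable_of_continuous c2)] at h0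
  have h1 : ∫ x : S2, x.1 1 ^ 2 * q.derivative.eval (x.1 2) ∂sphereMeasure =
      ∫ x : S2, x.1 0 ^ 2 * q.derivative.eval (x.1 2) ∂sphereMeasure := by
    rw [← integral_comp_rotate (rotXY (Real.pi / 2)) c1.aestronglyMeasurable]
    simp only [rotate_rotXY_one, rotate_rotXY_two]
    simp
  have h2 : axisIntegral (Polynomial.derivative ((1 - Polynomial.X ^ 2) * q)) =
      ∫ x : S2, (x.1 0 ^ 2 * q.derivative.eval (x.1 2) + x.1 1 ^ 2 * q.derivative.eval (x.1 2) -
        2 * (x.1 2 * q.eval (x.1 2))) ∂sphereMeasure := by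
    rw [axisIntegral_apply]
    refine integral_congr_ae (Filter.Eventually.of_forall fun x => ?_)
    have := sphere_sq_sum x
    simp only [Polynomial.derivative_mul, Polynomial.derivative_sub, Polynomial.derivative_one,
      Polynomial.derivative_X_pow, Polynomial.eval_add, Polynomial.eval_mul, Polynomial.eval_sub,
      Polynomial.eval_pow, Polynomial.eval_X, Polynomial.eval_one, Polynomial.eval_C,
      Polynomial.eval_zero]
    push_cast
    linear_combination -q.derivative.eval (x.1 2) * this
  have i0 := integrable_of_continuous c0
  have i1 := integrable_of_continuous c1
  have i2 := integrable_of_continuous c2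
  rw [h2, integral_sub (i0.fun_add i1) (i2.const_mul 2), integral_add i0 i1, h1, integral_const_mul]
  linarith

lemma continuous_rawHarmonic (ℓ m : ℕ) : Continuous (rawHarmonic ℓ m) := by
  unfold rawHarmonic
  refine Continuous.mul (by fun_prop) (Complex.continuous_ofReal.comp ?_)
  exact (Polynomial.continuous _).comp (continuous_coord 2)

/-- The Funk–Hecke formula for axially symmetric polynomials. -/
lemma integral_legendreP_mul_axis (ℓ : ℕ) (q : Polynomial ℝ) (x : S2) :
    ∫ z, (legendreP ℓ).eval (dot x z) * q.eval (z.1 2) ∂sphereMeasure =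
      (legendreP ℓ).eval (x.1 2) * axisIntegral (legendreP ℓ * q) := by
  have hqc : Continuous fun z : S2 => q.eval (z.1 2) := q.continuous.comp (continuous_coord 2)
  -- A turn by `π/(m+1)` about the polar axis changes the sign of the harmonic of order `m+1` and
  -- fixes `q(z₂)`, so the integral equals its opposite.
  have hzero : ∀ m : ℕ, ∫ z : S2, (rawHarmonic ℓ (m + 1) x *
      (starRingEnd ℂ) (rawHarmonic ℓ (m + 1) z)).re * q.eval (z.1 2) ∂sphereMeasure = 0 := by
    intro m
    have hc : Continuous fun z : S2 => (rawHarmonic ℓ (m + 1) x *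
        (starRingEnd ℂ) (rawHarmonic ℓ (m + 1) z)).re * q.eval (z.1 2) :=
      (Complex.continuous_re.comp (continuous_const.mul
        (Complex.continuous_conj.comp (continuous_rawHarmonic ℓ (m + 1))))).mul hqc
    have he : Complex.exp ((Real.pi / (m + 1 : ℝ) : ℝ) * Complex.I) ^ (m + 1) = -1 := by
      rw [← Complex.exp_nat_mul, ← Complex.exp_pi_mul_I]
      congr 1
      have : ((m : ℂ) + 1) ≠ 0 := by exact_mod_cast Nat.succ_ne_zero m
      push_cast
      field_simp
    have h := integral_comp_rotate (rotXY (Real.pi / (m + 1 : ℝ))) hc.aestronglyMeasurable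
    simp only [rawHarmonic_rotXY, he, rotate_rotXY_two, neg_mul, one_mul, map_neg, mul_neg,
      Complex.neg_re, integral_neg] at h
    linarith
  have hexp : ∀ z : S2, (legendreP ℓ).eval (dot x z) * q.eval (z.1 2) =
      (legendreP ℓ).eval (x.1 2) * (legendreP ℓ * q).eval (z.1 2) +
        ∑ m ∈ Finset.range ℓ, 2 * harmonicWeight ℓ (m + 1) *
          ((rawHarmonic ℓ (m + 1) x * (starRingEnd ℂ) (rawHarmonic ℓ (m + 1) z)).re *
            q.eval (z.1 2)) := by
    intro z
    rw [← harmonicKernel_eq, harmonicKernel, Complex.add_re, Complex.re_sum, add_mul,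
      Finset.sum_mul]
    congr 1
    · simp [rawHarmonic]; ring
    · refine Finset.sum_congr rfl fun m _ => ?_
      rw [Complex.re_ofReal_mul]; ring
  simp only [hexp]
  rw [integral_add, integral_const_mul, integral_finsetSum]
  · simp only [integral_const_mul, hzero, mul_zero, Finset.sum_const_zero, add_zero]
    rfl
  · intro m _
    refine integrable_of_continuous (continuous_const.mul (Continuous.mul ?_ hqc))
    exact Complex.continuous_re.comp (continuous_const.mul
        (Complex.continuous_conj.comp (continuous_rawHarmonic ℓ (m + 1))))
  · exact integrable_of_continuous
      (continuous_const.mul ((Polynomial.continuous _).comp (continuous_coord 2)))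
  · refine integrable_of_continuous (continuous_finsetSum _ fun m _ =>
      continuous_const.mul (Continuous.mul ?_ hqc))
    exact Complex.continuous_re.comp (continuous_const.mul
        (Complex.continuous_conj.comp (continuous_rawHarmonic ℓ (m + 1))))

lemma continuous_legendreL (ℓ : ℕ) : Continuous (legendreL ℓ) :=
  continuous_const.mul (Polynomial.continuous _)

lemma legendreL_one (ℓ : ℕ) : legendreL ℓ 1 = (2 * (ℓ : ℝ) + 1) / (4 * Real.pi) := by
  rw [legendreL, legendreP_eval_one, mul_one]

/-- The reproducing property of the kernels `L_ℓ`. -/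
theorem integral_legendreL_mul_legendreL (ℓ ℓ' : ℕ) (x y : S2) :
    ∫ z, legendreL ℓ (dot x z) * legendreL ℓ' (dot z y) ∂sphereMeasure =
      if ℓ = ℓ' then legendreL ℓ (dot x y) else 0 := by
  have hinv : ∀ ρ : EuclideanSpace ℝ (Fin 3) ≃ₗᵢ[ℝ] EuclideanSpace ℝ (Fin 3), ∀ x y,
      ∫ z, legendreL ℓ (dot (rotate ρ x) z) * legendreL ℓ' (dot z (rotate ρ y)) ∂sphereMeasure =
      ∫ z, legendreL ℓ (dot x z) * legendreL ℓ' (dot z y) ∂sphereMeasure := by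
    intro ρ x y
    rw [← integral_comp_rotate ρ]
    · simp only [dot_rotate]
    · exact (((continuous_legendreL ℓ).comp (continuous_dot_right _)).mul
        ((continuous_legendreL ℓ').comp (continuous_dot_left _))).aestronglyMeasurable
  obtain ⟨θ, φ, h⟩ := exists_rotXZ_rotXY_eq_northPole y
  rw [← hinv (rotXY θ) x y, ← hinv (rotXZ φ), ← dot_rotate (rotXY θ) x y, ← dot_rotate (rotXZ φ), h]
  generalize rotate (rotXZ φ) (rotate (rotXY θ) x) = x'
  have h1 := integral_legendreP_mul_axis ℓ (legendreP ℓ') x'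
  have h2 : ∀ z, legendreL ℓ (dot x' z) * legendreL ℓ' (dot z northPole) =
      ((2 * (ℓ : ℝ) + 1) / (4 * Real.pi) * ((2 * (ℓ' : ℝ) + 1) / (4 * Real.pi))) *
        ((legendreP ℓ).eval (dot x' z) * (legendreP ℓ').eval (z.1 2)) := by
    intro z
    rw [legendreL, legendreL, dot_northPole]; ring
  simp only [h2]
  rw [integral_const_mul, h1, dot_northPole]
  split_ifs with hℓ
  · subst hℓ
    have h3 := isFlatFunctional_axisIntegral.legendreP_sq ℓ
    rw [axisIntegral_one] at h3
    have hpi := Real.pi_pos.ne'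
    rw [legendreL]
    field_simp
    linear_combination (legendreP ℓ).eval (x'.1 2) * h3
  · rw [isFlatFunctional_axisIntegral.legendreP_mul_eq_zero hℓ]
    ring

/-! ### Zonal kernels -/

/-- The zonal function `∑_{ℓ < n} c_ℓ L_ℓ`. -/
def zonal (n : ℕ) (c : ℕ → ℝ) (u : ℝ) : ℝ := ∑ ℓ ∈ Finset.range n, c ℓ * legendreL ℓ u

lemma continuous_zonal (n : ℕ) (c : ℕ → ℝ) : Continuous (zonal n c) :=
  continuous_finsetSum _ fun ℓ _ => continuous_const.mul (continuous_legendreL ℓ)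

lemma integral_zonal_mul_zonal (n : ℕ) (c d : ℕ → ℝ) (x y : S2) :
    ∫ z, zonal n c (dot x z) * zonal n d (dot z y) ∂sphereMeasure =
      zonal n (fun ℓ => c ℓ * d ℓ) (dot x y) := by
  have hint : ∀ ℓ ℓ', Integrable
      (fun z => c ℓ * d ℓ' * (legendreL ℓ (dot x z) * legendreL ℓ' (dot z y))) sphereMeasure :=
    fun ℓ ℓ' => integrable_of_continuous (continuous_const.mul
      (((continuous_legendreL ℓ).comp (continuous_dot_right _)).mul
        ((continuous_legendreL ℓ').comp (continuous_dot_left _))))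
  have hexp : ∀ z, zonal n c (dot x z) * zonal n d (dot z y) =
      ∑ ℓ ∈ Finset.range n, ∑ ℓ' ∈ Finset.range n,
        c ℓ * d ℓ' * (legendreL ℓ (dot x z) * legendreL ℓ' (dot z y)) := by
    intro z
    rw [zonal, zonal, Finset.sum_mul_sum]
    exact Finset.sum_congr rfl fun _ _ => Finset.sum_congr rfl fun _ _ => by ring
  simp only [hexp]
  rw [integral_finsetSum _ fun ℓ _ => integrable_finsetSum _ fun ℓ' _ => hint ℓ ℓ']
  refine Finset.sum_congr rfl fun ℓ hℓ => ?_
  rw [integral_finsetSum _ fun ℓ' _ => hint ℓ ℓ']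
  simp only [integral_const_mul, integral_legendreL_mul_legendreL, mul_ite, mul_zero,
    Finset.sum_ite_eq, if_pos hℓ]

/-! ### Polynomials on the sphere are sums of spherical harmonics -/

section HarmonicDecomposition

open MvPolynomial

/-- The polynomial `X₀² + X₁² + X₂²`. -/
def radiusSq : MvPolynomial (Fin 3) ℂ := X 0 ^ 2 + X 1 ^ 2 + X 2 ^ 2

lemma polyLaplacian_apply (p : MvPolynomial (Fin 3) ℂ) : polyLaplacian p =
    pderiv 0 (pderiv 0 p) + pderiv 1 (pderiv 1 p) + pderiv 2 (pderiv 2 p) := by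
  simp [polyLaplacian, Fin.sum_univ_three]

/-- Leibniz's rule gives `Δ(r²) = 6` and a cross term `4 ∑ X_i ∂_i p`, which is `4 d p` by Euler's
identity. -/
lemma polyLaplacian_radiusSq_mul {p : MvPolynomial (Fin 3) ℂ} {d : ℕ} (hp : p.IsHomogeneous d) :
    polyLaplacian (radiusSq * p) = (6 + 4 * (d : MvPolynomial (Fin 3) ℂ)) * p +
      radiusSq * polyLaplacian p := by
  have he := hp.sum_X_mul_pderiv
  rw [Fin.sum_univ_three, nsmul_eq_mul] at he
  have h0 : pderiv (0 : Fin 3) radiusSq = 2 * X 0 := by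
    simp [radiusSq, pderiv_X]
  have h1 : pderiv (1 : Fin 3) radiusSq = 2 * X 1 := by
    simp [radiusSq, pderiv_X]
  have h2 : pderiv (2 : Fin 3) radiusSq = 2 * X 2 := by
    simp [radiusSq, pderiv_X]
  have hc : ∀ i : Fin 3, pderiv i (2 : MvPolynomial (Fin 3) ℂ) = 0 := fun i => by
    exact Derivation.map_natCast (pderiv i) 2
  simp only [polyLaplacian_apply, pderiv_mul, map_add, h0, h1, h2, pderiv_X_self, hc]
  linear_combination 4 * he

/-- The space of harmonic homogeneous polynomials of degree `d`. -/
def harmonicPoly (d : ℕ) : Submodule ℂ (MvPolynomial (Fin 3) ℂ) :=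
  homogeneousSubmodule (Fin 3) ℂ d ⊓ LinearMap.ker polyLaplacian

lemma isHomogeneous_radiusSq_pow_mul {h : MvPolynomial (Fin 3) ℂ} {d : ℕ}
    (hh : h.IsHomogeneous d) (i : ℕ) : (radiusSq ^ i * h).IsHomogeneous (2 * i + d) := by
  have : radiusSq.IsHomogeneous 2 := by
    unfold radiusSq
    refine ((?_ : IsHomogeneous _ 2).add ?_).add ?_ <;>
      simpa using (isHomogeneous_X ℂ _).pow 2
  exact (this.pow i).mul hh

/-- The constant never vanishes, so each product of a radial power and a harmonic polynomial is a
Laplacian of another such product. -/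
lemma polyLaplacian_radiusSq_pow_mul {h : MvPolynomial (Fin 3) ℂ} {d : ℕ}
    (hh : h ∈ harmonicPoly d) (i : ℕ) : polyLaplacian (radiusSq ^ (i + 1) * h) =
      ((2 * (i + 1) * (2 * i + 3 + 2 * d) : ℕ) : ℂ) • (radiusSq ^ i * h) := by
  have hhom : h.IsHomogeneous d := (mem_homogeneousSubmodule d h).mp hh.1
  have hker : polyLaplacian h = 0 := hh.2
  induction i with
  | zero =>
    rw [zero_add, pow_one, polyLaplacian_radiusSq_mul hhom, hker, pow_zero, smul_eq_C_mul,
      map_natCast]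
    push_cast
    ring
  | succ i ih =>
    rw [pow_succ', mul_assoc, polyLaplacian_radiusSq_mul (isHomogeneous_radiusSq_pow_mul hhom _), ih,
      smul_eq_C_mul, smul_eq_C_mul, map_natCast, map_natCast]
    push_cast
    ring

/-- The span of the products of powers of `radiusSq` and harmonic polynomials, of degree `k`. -/
def radialHarmonicSpan (k : ℕ) : Submodule ℂ (MvPolynomial (Fin 3) ℂ) :=
  Submodule.span ℂ {p | ∃ (i d : ℕ) (h : MvPolynomial (Fin 3) ℂ), 2 * i + d = k ∧
    h ∈ harmonicPoly d ∧ p = radiusSq ^ i * h}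

lemma radialHarmonicSpan_le_homogeneousSubmodule (k : ℕ) :
    radialHarmonicSpan k ≤ homogeneousSubmodule (Fin 3) ℂ k := by
  refine Submodule.span_le.mpr ?_
  rintro _ ⟨i, d, h, rfl, hh, rfl⟩
  exact isHomogeneous_radiusSq_pow_mul ((mem_homogeneousSubmodule d h).mp hh.1) i

lemma exists_polyLaplacian_eq {k : ℕ} {q : MvPolynomial (Fin 3) ℂ}
    (hq : q ∈ radialHarmonicSpan k) : ∃ p ∈ radialHarmonicSpan (k + 2), polyLaplacian p = q := by
  have : radialHarmonicSpan k ≤ (radialHarmonicSpan (k + 2)).map polyLaplacian := by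
    refine Submodule.span_le.mpr ?_
    rintro _ ⟨i, d, h, hk, hh, rfl⟩
    refine ⟨((2 * (i + 1) * (2 * i + 3 + 2 * d) : ℕ) : ℂ)⁻¹ • (radiusSq ^ (i + 1) * h),
      Submodule.smul_mem _ _ (Submodule.subset_span ⟨i + 1, d, h, by omega, hh, rfl⟩), ?_⟩
    rw [map_smul, polyLaplacian_radiusSq_pow_mul hh, smul_smul, inv_mul_cancel₀, one_smul]
    rw [Nat.cast_ne_zero]
    positivity
  exact this hq

/-- Induction on the degree: `Δp` has degree `k - 2`, so it is the Laplacian of some `q` in the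
span, and `p - q` is harmonic. In degree below 2 every polynomial is harmonic. -/
lemma homogeneousSubmodule_le_radialHarmonicSpan (k : ℕ) :
    homogeneousSubmodule (Fin 3) ℂ k ≤ radialHarmonicSpan k := by
  induction k using Nat.strong_induction_on with
  | _ k ih =>
    intro p hp
    have hhom : p.IsHomogeneous k := (mem_homogeneousSubmodule k p).mp hp
    have hharm : ∀ r ∈ harmonicPoly k, r ∈ radialHarmonicSpan k := fun r hr =>
      Submodule.subset_span ⟨0, k, r, by omega, hr, by simp⟩
    have hlap : (polyLaplacian p).IsHomogeneous (k - 1 - 1) := by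
      rw [polyLaplacian_apply]
      exact (hhom.pderiv.pderiv.add hhom.pderiv.pderiv).add hhom.pderiv.pderiv
    rcases lt_or_ge k 2 with hk | hk
    · refine hharm p ⟨hp, ?_⟩
      have h0 : ∀ i : Fin 3, pderiv i (pderiv i p) = 0 := by
        intro i
        have h1 : (pderiv i p).IsHomogeneous 0 := by
          have := hhom.pderiv (i := i)
          rwa [show k - 1 = 0 by omega] at this
        rw [← totalDegree_zero_iff_isHomogeneous, totalDegree_eq_zero_iff_eq_C] at h1
        rw [h1, pderiv_C]
      rw [SetLike.mem_coe, LinearMap.mem_ker, polyLaplacian_apply, h0, h0, h0, add_zero, add_zero]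
    · obtain ⟨n, rfl⟩ := Nat.exists_eq_add_of_le' hk
      obtain ⟨q, hq, hqe⟩ := exists_polyLaplacian_eq (ih n (by omega)
        ((mem_homogeneousSubmodule n _).mpr hlap))
      have h1 : p - q ∈ harmonicPoly (n + 2) :=
        ⟨Submodule.sub_mem _ hp (radialHarmonicSpan_le_homogeneousSubmodule _ hq), by
          rw [SetLike.mem_coe, LinearMap.mem_ker, map_sub, hqe, sub_self]⟩
      have h2 := Submodule.add_mem _ (hharm _ h1) hq
      rwa [sub_add_cancel] at h2

lemma restrictToSphere_mul (p q : MvPolynomial (Fin 3) ℂ) :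
    restrictToSphere (p * q) = restrictToSphere p * restrictToSphere q := by
  funext x; simp [restrictToSphere]

lemma restrictToSphere_radiusSq_pow_mul (i : ℕ) (h : MvPolynomial (Fin 3) ℂ) :
    restrictToSphere (radiusSq ^ i * h) = restrictToSphere h := by
  funext x
  have hx := congrArg (fun r : ℝ => (r : ℂ)) (sphere_sq_sum x)
  push_cast at hx
  simp [restrictToSphere, radiusSq, hx]

/-- Powers of `r²` restrict to `1`, so each homogeneous component becomes a sum of harmonics of no
larger degree. -/
lemma restrictToSphere_mem_iSup {p : MvPolynomial (Fin 3) ℂ} {n : ℕ} (hp : p.totalDegree ≤ n) :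
    restrictToSphere p ∈ ⨆ ℓ ∈ Set.Iic n, harmonicSpace ℓ := by
  rw [← sum_homogeneousComponent p, map_sum]
  refine Submodule.sum_mem _ fun k hk => ?_
  have hkn : k ≤ n := by rw [Finset.mem_range] at hk; omega
  have h1 : radialHarmonicSpan k ≤
      (⨆ ℓ ∈ Set.Iic n, harmonicSpace ℓ).comap restrictToSphere := by
    refine Submodule.span_le.mpr ?_
    rintro _ ⟨i, d, h, hd, hh, rfl⟩
    rw [SetLike.mem_coe, Submodule.mem_comap, restrictToSphere_radiusSq_pow_mul]
    exact Submodule.mem_iSup_of_mem d (Submodule.mem_iSup_of_mem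
      (show d ∈ Set.Iic n from Set.mem_Iic.mpr (by omega)) ⟨h, hh, rfl⟩)
  exact h1 (homogeneousSubmodule_le_radialHarmonicSpan k
    ((mem_homogeneousSubmodule k _).mpr (homogeneousComponent_isHomogeneous k p)))

lemma exists_restrictToSphere_eq_eval_dot (q : Polynomial ℝ) (x : S2) :
    ∃ p : MvPolynomial (Fin 3) ℂ, p.totalDegree ≤ q.natDegree ∧
      restrictToSphere p = fun z => ((q.eval (dot x z) : ℝ) : ℂ) := by
  let lin : MvPolynomial (Fin 3) ℂ :=
    C (x.1 0 : ℂ) * X 0 + C (x.1 1 : ℂ) * X 1 + C (x.1 2 : ℂ) * X 2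
  have hlin : lin.totalDegree ≤ 1 := by
    have h : ∀ (c : ℂ) (i : Fin 3), (C c * X i : MvPolynomial (Fin 3) ℂ).totalDegree ≤ 1 :=
      fun c i => (totalDegree_mul _ _).trans (by simp)
    exact (totalDegree_add _ _).trans (max_le ((totalDegree_add _ _).trans
      (max_le (h _ _) (h _ _))) (h _ _))
  refine ⟨∑ i ∈ Finset.range (q.natDegree + 1), C (q.coeff i : ℂ) * lin ^ i, ?_, ?_⟩
  · refine totalDegree_finsetSum_le fun i hi => ?_
    refine (totalDegree_mul _ _).trans ?_
    rw [totalDegree_C, zero_add]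
    refine (totalDegree_pow _ _).trans ?_
    rw [Finset.mem_range] at hi
    calc i * lin.totalDegree ≤ i * 1 := Nat.mul_le_mul_left _ hlin
      _ ≤ q.natDegree := by omega
  · funext z
    have he : eval (fun i : Fin 3 => ((z.1 i : ℝ) : ℂ)) lin = ((dot x z : ℝ) : ℂ) := by
      simp [lin, dot_eq]
    change eval (fun i : Fin 3 => ((z.1 i : ℝ) : ℂ)) _ = _
    rw [Polynomial.eval_eq_sum_range]
    simp [he]

end HarmonicDecomposition

/-! ### Cubature for products of zonal kernels. -/

lemma IsPixelization.sum_eq_integral {c₀ : ℝ} {L N : ℕ} {ξ : Fin N → S2} {lam : Fin N → ℝ}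
    (h : IsPixelization c₀ L N ξ lam) (p q : Polynomial ℝ) (hpq : p.natDegree + q.natDegree ≤ L)
    (x y : S2) : ∑ k, lam k * (p.eval (dot x (ξ k)) * q.eval (dot (ξ k) y)) =
      ∫ z, p.eval (dot x z) * q.eval (dot z y) ∂sphereMeasure := by
  obtain ⟨p', hp', hpe⟩ := exists_restrictToSphere_eq_eval_dot p x
  obtain ⟨q', hq', hqe⟩ := exists_restrictToSphere_eq_eval_dot q y
  have h1 := h.cubature _ (restrictToSphere_mem_iSup (p := p' * q') (n := L)
    ((MvPolynomial.totalDegree_mul _ _).trans (by omega)))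
  rw [restrictToSphere_mul, hpe, hqe] at h1
  simp only [Pi.mul_apply, ← Complex.ofReal_mul, integral_complex_ofReal, ← Complex.ofReal_sum]
    at h1
  simp only [dot_comm _ y]
  exact_mod_cast h1.symm

/-- The polynomial underlying a zonal kernel. -/
def zonalPoly (n : ℕ) (c : ℕ → ℝ) : Polynomial ℝ :=
  ∑ ℓ ∈ Finset.range n,
    Polynomial.C (c ℓ * ((2 * (ℓ : ℝ) + 1) / (4 * Real.pi))) * legendreP ℓ

lemma zonalPoly_eval (n : ℕ) (c : ℕ → ℝ) (u : ℝ) : (zonalPoly n c).eval u = zonal n c u := by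
  simp [zonalPoly, zonal, Polynomial.eval_finsetSum, legendreL, mul_assoc]

lemma natDegree_zonalPoly_le (n : ℕ) (c : ℕ → ℝ) : (zonalPoly (n + 1) c).natDegree ≤ n := by
  refine Polynomial.natDegree_sum_le_of_forall_le _ _ fun ℓ hℓ => ?_
  refine (Polynomial.natDegree_C_mul_le _ _).trans ?_
  rw [natDegree_legendreP]
  rw [Finset.mem_range] at hℓ
  omega

/-- Each factor has degree at most `2n`, whence the order `4n` required of the pixelization. -/
lemma IsPixelization.sum_zonal_mul_zonal {c₀ : ℝ} {n N : ℕ} {ξ : Fin N → S2} {lam : Fin N → ℝ}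
    (h : IsPixelization c₀ (4 * n) N ξ lam) (c d : ℕ → ℝ) (x y : S2) :
    ∑ k, lam k * (zonal (2 * n + 1) c (dot x (ξ k)) * zonal (2 * n + 1) d (dot (ξ k) y)) =
      zonal (2 * n + 1) (fun ℓ => c ℓ * d ℓ) (dot x y) := by
  rw [← integral_zonal_mul_zonal]
  simp only [← zonalPoly_eval]
  refine h.sum_eq_integral _ _ ?_ x y
  have h1 := natDegree_zonalPoly_le (2 * n) c
  have h2 := natDegree_zonalPoly_le (2 * n) d
  omega

lemma IsPixelization.sum_weight {c₀ : ℝ} {L N : ℕ} {ξ : Fin N → S2} {lam : Fin N → ℝ}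
    (h : IsPixelization c₀ L N ξ lam) : ∑ k, lam k = 4 * Real.pi := by
  have h1 := h.sum_eq_integral 1 1 (by simp) northPole northPole
  simpa [sphereMeasure_real_univ] using h1

/-! ### Second moments of integrals of a random field -/

section SecondMoments

variable {Ω : Type*} [MeasurableSpace Ω]

/-- A jointly measurable random field that is square integrable on the product space. -/
structure IsSquareIntegrableField (X : S2 → Ω → ℝ) (P : Measure Ω) : Prop where
  measurable : Measurable (fun z : S2 × Ω => X z.1 z.2)
  integrable_sq : Integrable (fun z : S2 × Ω => X z.1 z.2 ^ 2) (sphereMeasure.prod P)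

/-- The integral of a field against a function on the sphere. -/
def fieldIntegral (X : S2 → Ω → ℝ) (f : S2 → ℝ) (ω : Ω) : ℝ :=
  ∫ y, X y ω * f y ∂sphereMeasure

/-- The covariance function of a field. -/
def fieldCov (X : S2 → Ω → ℝ) (P : Measure Ω) (z : S2 × S2) : ℝ := ∫ ω, X z.1 ω * X z.2 ω ∂P

/-- The integral of a kernel against the covariance function of a field. -/
def covIntegral (X : S2 → Ω → ℝ) (P : Measure Ω) (k : S2 × S2 → ℝ) : ℝ :=
  ∫ z, fieldCov X P z * k z ∂(sphereMeasure.prod sphereMeasure)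

variable {P : Measure Ω} [IsProbabilityMeasure P] {X : S2 → Ω → ℝ}

lemma exists_bound_of_continuous {T : Type*} [TopologicalSpace T] [CompactSpace T] {f : T → ℝ}
    (hf : Continuous f) : ∃ C, 0 ≤ C ∧ ∀ x, |f x| ≤ C := by
  obtain ⟨C, hC⟩ := isCompact_univ.exists_bound_of_continuousOn hf.continuousOn
  exact ⟨max C 0, le_max_right _ _, fun x => (hC x (Set.mem_univ x)).trans (le_max_left _ _)⟩

lemma integrable_fst_snd {g : S2 × Ω → ℝ} (hgm : Measurable g)
    (hg : Integrable g (sphereMeasure.prod P)) :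
    Integrable (fun w : (S2 × S2) × Ω => g (w.1.1, w.2))
      ((sphereMeasure.prod sphereMeasure).prod P) := by
  have hm : Measurable fun w : (S2 × S2) × Ω => g (w.1.1, w.2) :=
    hgm.comp (measurable_fst.fst.prodMk measurable_snd)
  rw [integrable_prod_iff' hm.aestronglyMeasurable]
  constructor
  · filter_upwards [hg.prod_left_ae] with ω hω
    exact hω.comp_fst sphereMeasure
  · have h1 : ∀ ω, ∫ z : S2 × S2, ‖g (z.1, ω)‖ ∂(sphereMeasure.prod sphereMeasure) =
        (∫ y, ‖g (y, ω)‖ ∂sphereMeasure) * (4 * Real.pi) := by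
      intro ω
      have := integral_prod_mul (μ := sphereMeasure) (ν := sphereMeasure)
        (fun y => ‖g (y, ω)‖) (fun _ => (1 : ℝ))
      simpa [sphereMeasure_real_univ] using this
    simp only [h1]
    exact hg.norm.integral_prod_right.mul_const _

lemma integrable_snd_snd {g : S2 × Ω → ℝ} (hgm : Measurable g)
    (hg : Integrable g (sphereMeasure.prod P)) :
    Integrable (fun w : (S2 × S2) × Ω => g (w.1.2, w.2))
      ((sphereMeasure.prod sphereMeasure).prod P) := by
  have hmp : MeasurePreserving (fun w : (S2 × S2) × Ω => (w.1.swap, w.2))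
      ((sphereMeasure.prod sphereMeasure).prod P) ((sphereMeasure.prod sphereMeasure).prod P) :=
    Measure.measurePreserving_swap.prod (MeasurePreserving.id P)
  exact hmp.integrable_comp_of_integrable (integrable_fst_snd hgm hg)

namespace IsSquareIntegrableField

lemma integrable (hX : IsSquareIntegrableField X P) :
    Integrable (fun z : S2 × Ω => X z.1 z.2) (sphereMeasure.prod P) :=
  ((memLp_two_iff_integrable_sq hX.measurable.aestronglyMeasurable).mpr
    hX.integrable_sq).integrable (by norm_num)

/-- The product of two values of the field is dominated by the sum of their squares, and a
continuous kernel is bounded. This justifies every later use of Fubini for second moments. -/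
lemma integrable_kernel (hX : IsSquareIntegrableField X P) {k : S2 × S2 → ℝ} (hk : Continuous k) :
    Integrable (fun w : (S2 × S2) × Ω => X w.1.1 w.2 * X w.1.2 w.2 * k w.1)
      ((sphereMeasure.prod sphereMeasure).prod P) := by
  obtain ⟨C, hC0, hC⟩ := exists_bound_of_continuous hk
  have hm1 : Measurable fun w : (S2 × S2) × Ω => X w.1.1 w.2 :=
    hX.measurable.comp (measurable_fst.fst.prodMk measurable_snd)
  have hm2 : Measurable fun w : (S2 × S2) × Ω => X w.1.2 w.2 :=
    hX.measurable.comp (measurable_fst.snd.prodMk measurable_snd)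
  refine (((integrable_fst_snd (hX.measurable.pow_const 2) hX.integrable_sq).add
    (integrable_snd_snd (hX.measurable.pow_const 2) hX.integrable_sq)).mul_const C).mono'
    ((hm1.mul hm2).mul (hk.measurable.comp measurable_fst)).aestronglyMeasurable
    (Eventually.of_forall fun w => ?_)
  rw [Real.norm_eq_abs, abs_mul, abs_mul, Pi.add_apply]
  refine mul_le_mul ?_ (hC _) (abs_nonneg _) (by positivity)
  rw [← sq_abs (X w.1.1 w.2), ← sq_abs (X w.1.2 w.2)]
  nlinarith [sq_nonneg (|X w.1.1 w.2| - |X w.1.2 w.2|), sq_nonneg (|X w.1.1 w.2| + |X w.1.2 w.2|)]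

lemma integrable_fieldCov_mul (hX : IsSquareIntegrableField X P) {k : S2 × S2 → ℝ}
    (hk : Continuous k) :
    Integrable (fun z => fieldCov X P z * k z) (sphereMeasure.prod sphereMeasure) := by
  have h := (hX.integrable_kernel hk).integral_prod_left
  simp only [integral_mul_const] at h
  exact h

lemma covIntegral_sum (hX : IsSquareIntegrableField X P) {ι : Type*} (s : Finset ι) (c : ι → ℝ)
    (k : ι → S2 × S2 → ℝ) (hk : ∀ i ∈ s, Continuous (k i)) :
    covIntegral X P (fun z => ∑ i ∈ s, c i * k i z) = ∑ i ∈ s, c i * covIntegral X P (k i) := by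
  simp only [covIntegral, Finset.mul_sum, ← integral_const_mul]
  rw [← integral_finsetSum]
  · exact integral_congr_ae (Eventually.of_forall fun z =>
      Finset.sum_congr rfl fun i _ => by ring)
  · intro i hi
    exact (hX.integrable_fieldCov_mul (hk i hi)).const_mul _

lemma fieldIntegral_mul_eq {Ω : Type*} {X : S2 → Ω → ℝ} (f g : S2 → ℝ) (ω : Ω) :
    fieldIntegral X f ω * fieldIntegral X g ω =
      ∫ z, X z.1 ω * X z.2 ω * (f z.1 * g z.2) ∂(sphereMeasure.prod sphereMeasure) := by
  rw [fieldIntegral, fieldIntegral, ← integral_prod_mul]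
  exact integral_congr_ae (Eventually.of_forall fun z => by ring)

lemma integrable_fieldIntegral_mul (hX : IsSquareIntegrableField X P) {f g : S2 → ℝ}
    (hf : Continuous f) (hg : Continuous g) :
    Integrable (fun ω => fieldIntegral X f ω * fieldIntegral X g ω) P := by
  simp only [fieldIntegral_mul_eq]
  exact (hX.integrable_kernel (k := fun z => f z.1 * g z.2) (by fun_prop)).integral_prod_right

lemma integral_fieldIntegral_mul (hX : IsSquareIntegrableField X P) {f g : S2 → ℝ}
    (hf : Continuous f) (hg : Continuous g) :
    ∫ ω, fieldIntegral X f ω * fieldIntegral X g ω ∂P =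
      covIntegral X P (fun z => f z.1 * g z.2) := by
  simp only [fieldIntegral_mul_eq, covIntegral, fieldCov, ← integral_mul_const]
  exact (integral_integral_swap (f := fun (z : S2 × S2) (ω : Ω) =>
    X z.1 ω * X z.2 ω * (f z.1 * g z.2))
    (hX.integrable_kernel (k := fun z => f z.1 * g z.2) (by fun_prop))).symm

lemma memLp_fieldIntegral (hX : IsSquareIntegrableField X P) {f : S2 → ℝ} (hf : Continuous f) :
    MemLp (fieldIntegral X f) 2 P := by
  refine (memLp_two_iff_integrable_sq ?_).mpr ?_
  · have h : StronglyMeasurable fun z : S2 × Ω => X z.1 z.2 * f z.1 :=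
      (hX.measurable.mul (hf.measurable.comp measurable_fst)).stronglyMeasurable
    exact h.integral_prod_left'.aestronglyMeasurable
  · simpa only [sq] using hX.integrable_fieldIntegral_mul hf hf

lemma integrable_section (hX : IsSquareIntegrableField X P) :
    ∀ᵐ ω ∂P, Integrable (fun y => X y ω) sphereMeasure :=
  hX.integrable.prod_left_ae

lemma integral_fieldIntegral_mul_eq_zero (hX : IsSquareIntegrableField X P) {f : S2 → ℝ}
    (hf : Continuous f) {V : Ω → ℝ} (hV : MemLp V 2 P) (h0 : ∀ y, ∫ ω, X y ω * V ω ∂P = 0) :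
    ∫ ω, fieldIntegral X f ω * V ω ∂P = 0 := by
  have hint : Integrable (fun z : S2 × Ω => f z.1 * (X z.1 z.2 * V z.2))
      (sphereMeasure.prod P) := by
    have h1 : MemLp (fun z : S2 × Ω => X z.1 z.2) 2 (sphereMeasure.prod P) :=
      (memLp_two_iff_integrable_sq hX.measurable.aestronglyMeasurable).mpr hX.integrable_sq
    have h2 : MemLp (fun z : S2 × Ω => V z.2) 2 (sphereMeasure.prod P) :=
      (memLp_two_iff_integrable_sq hV.aestronglyMeasurable.comp_snd).mpr
        (hV.integrable_sq.comp_snd sphereMeasure)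
    obtain ⟨C, -, hC⟩ := exists_bound_of_continuous hf
    exact (h1.integrable_mul h2).bdd_mul
      (hf.measurable.comp measurable_fst).aestronglyMeasurable (Eventually.of_forall fun z => hC z.1)
  have h1 : ∀ ω, fieldIntegral X f ω * V ω = ∫ y, f y * (X y ω * V ω) ∂sphereMeasure := by
    intro ω
    rw [fieldIntegral, ← integral_mul_const]
    exact integral_congr_ae (Eventually.of_forall fun y => by ring)
  simp only [h1]
  rw [← integral_integral_swap (f := fun y ω => f y * (X y ω * V ω)) hint]
  simp only [integral_const_mul, h0, mul_zero, integral_zero]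

end IsSquareIntegrableField

end SecondMoments

/-! ### Stationary fields -/

section Stationary

variable {Ω : Type*} [MeasurableSpace Ω] {P : Measure Ω} {X : S2 → Ω → ℝ}

lemma powerSpectrum_nonneg (ℓ : ℕ) : 0 ≤ powerSpectrum X P ℓ := by
  unfold powerSpectrum
  refine mul_nonneg (by positivity) (Finset.sum_nonneg fun m _ => integral_nonneg fun ω => ?_)
  positivity

namespace IsStationaryGaussianField

lemma integral_sq_eq (hX : IsStationaryGaussianField X P) (x : S2) :
    ∫ ω, X x ω ^ 2 ∂P = ∫ ω, X northPole ω ^ 2 ∂P := by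
  simp only [sq]
  exact eq_northPole_of_rotation_invariant (fun x => ∫ ω, X x ω * X x ω ∂P)
    (fun ρ hρ x => hX.stationary ρ hρ x x) x

lemma fieldCov_rotate (hX : IsStationaryGaussianField X P)
    {ρ : EuclideanSpace ℝ (Fin 3) ≃ₗᵢ[ℝ] EuclideanSpace ℝ (Fin 3)} (hρ : IsRotation ρ) :
    fieldCov (fun x => X (rotate ρ x)) P = fieldCov X P := by
  funext z
  exact hX.stationary ρ hρ z.1 z.2

variable [IsProbabilityMeasure P]

lemma isSquareIntegrableField (hX : IsStationaryGaussianField X P) :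
    IsSquareIntegrableField X P := by
  refine ⟨hX.measurable, ?_⟩
  rw [integrable_prod_iff (hX.measurable.pow_const 2).aestronglyMeasurable]
  refine ⟨Eventually.of_forall fun x => (hX.memLp x).integrable_sq, ?_⟩
  simp only [Real.norm_eq_abs, abs_sq, hX.integral_sq_eq]
  exact integrable_const _

lemma isSquareIntegrableField_rotate (hX : IsStationaryGaussianField X P)
    (ρ : EuclideanSpace ℝ (Fin 3) ≃ₗᵢ[ℝ] EuclideanSpace ℝ (Fin 3)) :
    IsSquareIntegrableField (fun x => X (rotate ρ x)) P := by
  have hm : Measurable fun z : S2 × Ω => X (rotate ρ z.1) z.2 :=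
    hX.measurable.comp (((continuous_rotate ρ).measurable.comp measurable_fst).prodMk
      measurable_snd)
  refine ⟨hm, ?_⟩
  rw [integrable_prod_iff (hm.pow_const 2).aestronglyMeasurable]
  refine ⟨Eventually.of_forall fun x => (hX.memLp (rotate ρ x)).integrable_sq, ?_⟩
  simp only [Real.norm_eq_abs, abs_sq, hX.integral_sq_eq]
  exact integrable_const _

/-- The convolution of a stationary field with a zonal kernel has constant variance. -/
lemma integral_sq_zonal_eq (hX : IsStationaryGaussianField X P) {K : ℝ → ℝ} (hK : Continuous K)
    (x : S2) : ∫ ω, fieldIntegral X (fun y => K (dot x y)) ω ^ 2 ∂P =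
      ∫ ω, fieldIntegral X (fun y => K (dot northPole y)) ω ^ 2 ∂P := by
  refine eq_northPole_of_rotation_invariant
    (fun x => ∫ ω, fieldIntegral X (fun y => K (dot x y)) ω ^ 2 ∂P) (fun ρ hρ x => ?_) x
  have hc : ∀ x, Continuous fun y => K (dot x y) := fun x => hK.comp (continuous_dot_right x)
  -- A change of variables moves the rotation from the kernel to the field; the second moment then
  -- sees it only through the covariance, which is invariant.
  have h1 : ∀ ω, fieldIntegral X (fun y => K (dot (rotate ρ x) y)) ω =
      fieldIntegral (fun y => X (rotate ρ y)) (fun y => K (dot x y)) ω := by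
    intro ω
    rw [fieldIntegral, ← integral_comp_rotate ρ]
    · simp only [dot_rotate]; rfl
    · exact ((hX.measurable.comp measurable_prodMk_right).mul
        (hc _).measurable).aestronglyMeasurable
  simp only [h1, sq]
  rw [(hX.isSquareIntegrableField_rotate ρ).integral_fieldIntegral_mul (hc x) (hc x),
    hX.isSquareIntegrableField.integral_fieldIntegral_mul (hc x) (hc x), covIntegral, covIntegral,
    hX.fieldCov_rotate hρ]

end IsStationaryGaussianField

lemma continuous_sphericalHarmonic (ℓ : ℕ) (m : ℤ) : Continuous (sphericalHarmonic ℓ m) := by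
  unfold sphericalHarmonic
  refine Continuous.mul (by fun_prop) (Complex.continuous_ofReal.comp ?_)
  exact (Polynomial.continuous _).comp (continuous_coord 2)

lemma sum_re_sphericalHarmonic (ℓ : ℕ) (x y : S2) :
    ∑ m ∈ Finset.Icc (-(ℓ : ℤ)) ℓ, ((sphericalHarmonic ℓ m x).re * (sphericalHarmonic ℓ m y).re +
      (sphericalHarmonic ℓ m x).im * (sphericalHarmonic ℓ m y).im) = legendreL ℓ (dot x y) := by
  have h := congrArg Complex.re (sum_sphericalHarmonic_mul_conj ℓ x y)
  rw [Complex.re_sum, Complex.ofReal_re] at h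
  rw [← h]
  refine Finset.sum_congr rfl fun m _ => ?_
  simp [Complex.mul_re]

lemma harmonicCoeff_eq {Ω : Type*} {X : S2 → Ω → ℝ} {ω : Ω}
    (hω : Integrable (fun y => X y ω) sphereMeasure) (ℓ : ℕ) (m : ℤ) :
    harmonicCoeff X ℓ m ω = ⟨fieldIntegral X (fun y => (sphericalHarmonic ℓ m y).re) ω,
      -fieldIntegral X (fun y => (sphericalHarmonic ℓ m y).im) ω⟩ := by
  have hc := continuous_sphericalHarmonic ℓ m
  have hint : Integrable (fun y => (X y ω : ℂ) * (starRingEnd ℂ) (sphericalHarmonic ℓ m y))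
      sphereMeasure := by
    obtain ⟨C, hC⟩ := isCompact_univ.exists_bound_of_continuousOn hc.continuousOn
    exact hω.ofReal.mul_bdd (c := C)
      (Complex.continuous_conj.comp hc).aestronglyMeasurable
      (Eventually.of_forall fun y => by simpa using hC y (Set.mem_univ y))
  apply Complex.ext
  · rw [harmonicCoeff, ← RCLike.re_eq_complex_re, ← integral_re hint]
    simp [fieldIntegral]
  · rw [harmonicCoeff, ← RCLike.im_eq_complex_im, ← integral_im hint]
    simp [fieldIntegral, integral_neg]

namespace IsStationaryGaussianField

/-- The power spectrum in terms of the covariance function. -/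
lemma powerSpectrum_eq [IsProbabilityMeasure P] (hX : IsStationaryGaussianField X P) (ℓ : ℕ) :
    (2 * (ℓ : ℝ) + 1) * powerSpectrum X P ℓ =
      covIntegral X P (fun z => legendreL ℓ (dot z.1 z.2)) := by
  have hS := hX.isSquareIntegrableField
  have hre : ∀ m, Continuous fun y => (sphericalHarmonic ℓ m y).re := fun m =>
    Complex.continuous_re.comp (continuous_sphericalHarmonic ℓ m)
  have him : ∀ m, Continuous fun y => (sphericalHarmonic ℓ m y).im := fun m =>
    Complex.continuous_im.comp (continuous_sphericalHarmonic ℓ m)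
  have hk : ∀ m : ℤ, Continuous fun z : S2 × S2 =>
      (sphericalHarmonic ℓ m z.1).re * (sphericalHarmonic ℓ m z.2).re +
        (sphericalHarmonic ℓ m z.1).im * (sphericalHarmonic ℓ m z.2).im := fun m =>
    (((hre m).comp continuous_fst).mul ((hre m).comp continuous_snd)).add
      (((him m).comp continuous_fst).mul ((him m).comp continuous_snd))
  have h1 : ∀ m : ℤ, ∫ ω, ‖harmonicCoeff X ℓ m ω‖ ^ 2 ∂P = covIntegral X P (fun z =>
      (sphericalHarmonic ℓ m z.1).re * (sphericalHarmonic ℓ m z.2).re +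
        (sphericalHarmonic ℓ m z.1).im * (sphericalHarmonic ℓ m z.2).im) := by
    intro m
    have h2 : ∀ᵐ ω ∂P, ‖harmonicCoeff X ℓ m ω‖ ^ 2 =
        fieldIntegral X (fun y => (sphericalHarmonic ℓ m y).re) ω *
          fieldIntegral X (fun y => (sphericalHarmonic ℓ m y).re) ω +
        fieldIntegral X (fun y => (sphericalHarmonic ℓ m y).im) ω *
          fieldIntegral X (fun y => (sphericalHarmonic ℓ m y).im) ω := by
      filter_upwards [hS.integrable_section] with ω hω
      rw [harmonicCoeff_eq hω, ← Complex.normSq_eq_norm_sq, Complex.normSq_mk]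
      ring
    rw [integral_congr_ae h2, integral_add (hS.integrable_fieldIntegral_mul (hre m) (hre m))
      (hS.integrable_fieldIntegral_mul (him m) (him m)),
      hS.integral_fieldIntegral_mul (hre m) (hre m), hS.integral_fieldIntegral_mul (him m) (him m)]
    simp only [covIntegral, mul_add]
    rw [← integral_add]
    · exact hS.integrable_fieldCov_mul
        (((hre m).comp continuous_fst).mul ((hre m).comp continuous_snd))
    · exact hS.integrable_fieldCov_mul
        (((him m).comp continuous_fst).mul ((him m).comp continuous_snd))
  -- Summing over `m` inside the covariance integral produces `L_ℓ` by the addition theorem.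
  have h3 := hS.covIntegral_sum (Finset.Icc (-(ℓ : ℤ)) ℓ) (fun _ => 1) _ (fun m _ => hk m)
  simp only [one_mul, sum_re_sphericalHarmonic] at h3
  rw [h3, powerSpectrum]
  simp only [h1]
  have : (2 * (ℓ : ℝ) + 1) ≠ 0 := by positivity
  field_simp

/-- The variance of the convolution of a stationary field with a zonal kernel. -/
theorem integral_sq_fieldIntegral_zonal [IsProbabilityMeasure P]
    (hX : IsStationaryGaussianField X P) (n : ℕ) (c : ℕ → ℝ) (x : S2) : ∫ ω, fieldIntegral X (fun y => zonal n c (dot x y)) ω ^ 2 ∂P =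
      (4 * Real.pi)⁻¹ *
        ∑ ℓ ∈ Finset.range n, (2 * (ℓ : ℝ) + 1) * c ℓ ^ 2 * powerSpectrum X P ℓ := by
  have hS := hX.isSquareIntegrableField
  have hc : ∀ x, Continuous fun y => zonal n c (dot x y) := fun x =>
    (continuous_zonal n c).comp (continuous_dot_right x)
  have h1 : ∀ x, ∫ ω, fieldIntegral X (fun y => zonal n c (dot x y)) ω ^ 2 ∂P =
      covIntegral X P (fun z => zonal n c (dot x z.1) * zonal n c (dot x z.2)) := by
    intro x
    simp only [sq]
    exact hS.integral_fieldIntegral_mul (hc x) (hc x)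
  have hint : Integrable (fun w : S2 × (S2 × S2) => fieldCov X P w.2 *
      (zonal n c (dot w.1 w.2.1) * zonal n c (dot w.1 w.2.2)))
      (sphereMeasure.prod (sphereMeasure.prod sphereMeasure)) := by
    have h2 : Integrable (fun z => fieldCov X P z) (sphereMeasure.prod sphereMeasure) := by
      simpa using hS.integrable_fieldCov_mul (k := fun _ => 1) continuous_const
    have hcont : Continuous fun w : S2 × (S2 × S2) =>
        zonal n c (dot w.1 w.2.1) * zonal n c (dot w.1 w.2.2) :=
      ((continuous_zonal n c).comp (continuous_dot.comp
        (continuous_fst.prodMk continuous_snd.fst))).mul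
      ((continuous_zonal n c).comp (continuous_dot.comp
        (continuous_fst.prodMk continuous_snd.snd)))
    obtain ⟨C, -, hC⟩ := exists_bound_of_continuous hcont
    exact (h2.comp_snd sphereMeasure).mul_bdd (c := C) hcont.aestronglyMeasurable
      (Eventually.of_forall hC)
  -- Integrating over the centre `x` first composes the kernel with itself, which squares its
  -- coefficients.
  have h2 : ∫ x, covIntegral X P (fun z => zonal n c (dot x z.1) * zonal n c (dot x z.2))
      ∂sphereMeasure = covIntegral X P (fun z => zonal n (fun ℓ => c ℓ * c ℓ) (dot z.1 z.2)) := by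
    simp only [covIntegral]
    rw [integral_integral_swap hint]
    refine integral_congr_ae (Eventually.of_forall fun z => ?_)
    simp only [integral_const_mul, ← integral_zonal_mul_zonal]
    simp only [dot_comm z.1]
  -- The variance is the same at every centre, so its integral is `4π` times its value at `x`.
  have h3 : ∫ x, covIntegral X P (fun z => zonal n c (dot x z.1) * zonal n c (dot x z.2))
      ∂sphereMeasure =
      4 * Real.pi * ∫ ω, fieldIntegral X (fun y => zonal n c (dot x y)) ω ^ 2 ∂P := by
    simp only [← h1]
    rw [hX.integral_sq_zonal_eq (continuous_zonal n c) x]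
    simp only [hX.integral_sq_zonal_eq (continuous_zonal n c)]
    rw [integral_const, sphereMeasure_real_univ, smul_eq_mul]
  have h4 := hS.covIntegral_sum (Finset.range n) (fun ℓ => c ℓ * c ℓ)
    (fun ℓ z => legendreL ℓ (dot z.1 z.2))
    (fun ℓ _ => (continuous_legendreL ℓ).comp continuous_dot)
  have h5 : 4 * Real.pi * ∫ ω, fieldIntegral X (fun y => zonal n c (dot x y)) ω ^ 2 ∂P =
      ∑ ℓ ∈ Finset.range n, (2 * (ℓ : ℝ) + 1) * c ℓ ^ 2 * powerSpectrum X P ℓ := by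
    rw [← h3, h2]
    refine h4.trans (Finset.sum_congr rfl fun ℓ _ => ?_)
    rw [← hX.powerSpectrum_eq]
    ring
  rw [← h5, inv_mul_cancel_left₀ (by positivity)]

end IsStationaryGaussianField

end Stationary

/-! ### Adding white noise -/

section Noise

variable {Ω : Type*} [MeasurableSpace Ω] {P : Measure Ω}

/-- Pythagoras in `L²`: only orthonormality of the `V i` and their orthogonality to `S` are needed.
-/
lemma integrable_and_integral_sq_add_noise {ι : Type*} [Fintype ι] [DecidableEq ι] {S : Ω → ℝ}
    (hS : MemLp S 2 P) {V : ι → Ω → ℝ} (hV : ∀ i, MemLp (V i) 2 P)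
    (hSV : ∀ i, ∫ ω, S ω * V i ω ∂P = 0)
    (hVV : ∀ i i', ∫ ω, V i ω * V i' ω ∂P = if i = i' then 1 else 0) (β : ι → ℝ) :
    Integrable (fun ω => (S ω + ∑ i, β i * V i ω) ^ 2) P ∧
      ∫ ω, (S ω + ∑ i, β i * V i ω) ^ 2 ∂P = ∫ ω, S ω ^ 2 ∂P + ∑ i, β i ^ 2 := by
  have hST : ∀ i, Integrable (fun ω => 2 * β i * (S ω * V i ω)) P := fun i =>
    (hS.integrable_mul (hV i)).const_mul _
  have hTT : ∀ i i', Integrable (fun ω => β i * β i' * (V i ω * V i' ω)) P := fun i i' =>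
    ((hV i).integrable_mul (hV i')).const_mul _
  have hexp : ∀ ω, (S ω + ∑ i, β i * V i ω) ^ 2 =
      (S ω ^ 2 + ∑ i, 2 * β i * (S ω * V i ω)) + ∑ i, ∑ i', β i * β i' * (V i ω * V i' ω) := by
    intro ω
    have h1 : (∑ i, β i * V i ω) * (∑ i, β i * V i ω) =
        ∑ i, ∑ i', β i * β i' * (V i ω * V i' ω) := by
      rw [Finset.sum_mul_sum]
      exact Finset.sum_congr rfl fun _ _ => Finset.sum_congr rfl fun _ _ => by ring
    have h2 : 2 * S ω * ∑ i, β i * V i ω = ∑ i, 2 * β i * (S ω * V i ω) := by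
      rw [Finset.mul_sum]
      exact Finset.sum_congr rfl fun _ _ => by ring
    rw [← h1, ← h2]
    ring
  have hi1 : Integrable (fun ω => ∑ i, 2 * β i * (S ω * V i ω)) P :=
    integrable_finsetSum _ fun i _ => hST i
  have hi2 : Integrable (fun ω => ∑ i, ∑ i', β i * β i' * (V i ω * V i' ω)) P :=
    integrable_finsetSum _ fun i _ => integrable_finsetSum _ fun i' _ => hTT i i'
  simp only [hexp]
  refine ⟨(hS.integrable_sq.fun_add hi1).fun_add hi2, ?_⟩
  rw [integral_add (hS.integrable_sq.fun_add hi1) hi2, integral_add hS.integrable_sq hi1,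
    integral_finsetSum _ fun i _ => hST i,
    integral_finsetSum _ fun i _ => integrable_finsetSum _ fun i' _ => hTT i i']
  have h3 : ∀ i, ∫ ω, ∑ i', β i * β i' * (V i ω * V i' ω) ∂P = β i ^ 2 := by
    intro i
    rw [integral_finsetSum _ fun i' _ => hTT i i']
    simp [integral_const_mul, hVV, sq]
  simp [integral_const_mul, hSV, h3]

end Noise

/-! ### The low-passed field as a convolution, and its needlet coefficients. -/

lemma fieldIntegral_sum {Ω : Type*} {X : S2 → Ω → ℝ} {ω : Ω}
    (hω : Integrable (fun y => X y ω) sphereMeasure) {ι : Type*} (s : Finset ι) (c : ι → ℝ)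
    (f : ι → S2 → ℝ) (hf : ∀ i ∈ s, Continuous (f i)) :
    fieldIntegral X (fun y => ∑ i ∈ s, c i * f i y) ω = ∑ i ∈ s, c i * fieldIntegral X (f i) ω := by
  simp only [fieldIntegral, ← integral_const_mul]
  rw [← integral_finsetSum]
  · refine integral_congr_ae (Eventually.of_forall fun y => ?_)
    simp only [Finset.mul_sum]
    exact Finset.sum_congr rfl fun i _ => by ring
  · intro i hi
    obtain ⟨C, -, hC⟩ := exists_bound_of_continuous (hf i hi)
    exact (hω.mul_bdd (c := C) (hf i hi).aestronglyMeasurable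
      (Eventually.of_forall hC)).const_mul _

lemma sum_harmonicCoeff_mul_re {Ω : Type*} {X : S2 → Ω → ℝ} {ω : Ω}
    (hω : Integrable (fun y => X y ω) sphereMeasure) (ℓ : ℕ) (x : S2) :
    (∑ m ∈ Finset.Icc (-(ℓ : ℤ)) ℓ, harmonicCoeff X ℓ m ω * sphericalHarmonic ℓ m x).re =
      fieldIntegral X (fun y => legendreL ℓ (dot x y)) ω := by
  have hre : ∀ m, Continuous fun y => (sphericalHarmonic ℓ m y).re := fun m =>
    Complex.continuous_re.comp (continuous_sphericalHarmonic ℓ m)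
  have him : ∀ m, Continuous fun y => (sphericalHarmonic ℓ m y).im := fun m =>
    Complex.continuous_im.comp (continuous_sphericalHarmonic ℓ m)
  -- The Boolean index separates real and imaginary parts, so that the addition theorem becomes a
  -- single real linear combination.
  have h1 : (fun y => legendreL ℓ (dot x y)) = fun y =>
      ∑ i ∈ Finset.Icc (-(ℓ : ℤ)) ℓ ×ˢ (Finset.univ : Finset Bool),
        (if i.2 then (sphericalHarmonic ℓ i.1 x).re else (sphericalHarmonic ℓ i.1 x).im) *
        (if i.2 then (sphericalHarmonic ℓ i.1 y).re else (sphericalHarmonic ℓ i.1 y).im) := by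
    funext y
    rw [← sum_re_sphericalHarmonic, Finset.sum_product]
    simp
  have h2 : ∀ i : ℤ × Bool, Continuous fun y =>
      if i.2 then (sphericalHarmonic ℓ i.1 y).re else (sphericalHarmonic ℓ i.1 y).im := by
    rintro ⟨m, _ | _⟩
    · simpa using him m
    · simpa using hre m
  rw [h1, fieldIntegral_sum hω _ _ _ fun i _ => h2 i, Complex.re_sum, Finset.sum_product]
  refine Finset.sum_congr rfl fun m _ => ?_
  rw [harmonicCoeff_eq hω, Complex.mul_re]
  simp
  ring

namespace Design

variable {B : ℝ} {a : ℝ → ℝ} {c₀ κ : ℝ} (D : Design B a c₀ κ)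

/-- The number of degrees below the band limit of the low-pass filter. -/
def bandwidth (j : ℕ) : ℕ := 2 * D.L j + 1

/-- The low-passed field as an integral against a zonal kernel. -/
def signal {Ω : Type*} (X : S2 → Ω → ℝ) (j : ℕ) (x : S2) : Ω → ℝ :=
  fieldIntegral X (fun y => zonal (D.bandwidth j) (D.beam j) (dot x y))

lemma lowPass_eq_signal {Ω : Type*} {X : S2 → Ω → ℝ} {ω : Ω}
    (hω : Integrable (fun y => X y ω) sphereMeasure) (j : ℕ) (x : S2) :
    D.lowPass X j x ω = D.signal X j x ω := by
  have h1 : ∀ ℓ ∉ Finset.range (D.bandwidth j), ∑ m ∈ Finset.Icc (-(ℓ : ℤ)) (ℓ : ℤ),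
      (D.beam j ℓ : ℂ) * harmonicCoeff X ℓ m ω * sphericalHarmonic ℓ m x = 0 := by
    intro ℓ hℓ
    rw [Finset.mem_range, bandwidth] at hℓ
    simp [D.beam_high j ℓ (by omega)]
  rw [lowPass, tsum_eq_sum h1, signal, Complex.re_sum]
  simp only [zonal]
  rw [fieldIntegral_sum hω _ _ (fun ℓ y => legendreL ℓ (dot x y))
    fun ℓ _ => (continuous_legendreL ℓ).comp (continuous_dot_right x)]
  refine Finset.sum_congr rfl fun ℓ _ => ?_
  simp only [mul_assoc]
  rw [← Finset.mul_sum, Complex.re_ofReal_mul, sum_harmonicCoeff_mul_re hω]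

/-- The normalized needlet kernel between two pixels. -/
def kernel (j : ℕ) (k p : Fin (D.N j)) : ℝ :=
  zonal (D.bandwidth j) (window B a j) (dot (D.ξ j k) (D.ξ j p))

lemma window_eq_zero_of_notMem {j ℓ : ℕ} (hℓ : ℓ ∉ Finset.range (D.bandwidth j)) :
    window B a j ℓ = 0 := by
  rw [Finset.mem_range, bandwidth] at hℓ
  exact D.window_band j ℓ (by omega)

lemma needlet_eq (j : ℕ) (k p : Fin (D.N j)) :
    D.needlet j k (D.ξ j p) = Real.sqrt (D.lam j k) * D.kernel j k p := by
  rw [needlet, kernel, zonal, tsum_eq_sum (s := Finset.range (D.bandwidth j)), dot_comm]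
  intro ℓ hℓ
  rw [D.window_eq_zero_of_notMem hℓ, zero_mul]

lemma bandSpectrum_eq (C : ℕ → ℝ) (j : ℕ) : bandSpectrum B a C j = (4 * Real.pi)⁻¹ *
    ∑ ℓ ∈ Finset.range (D.bandwidth j), (2 * (ℓ : ℝ) + 1) * window B a j ℓ ^ 2 * C ℓ := by
  rw [bandSpectrum, tsum_eq_sum (s := Finset.range (D.bandwidth j))]
  intro ℓ hℓ
  rw [D.window_eq_zero_of_notMem hℓ]
  ring

lemma lam_pos (j : ℕ) (k : Fin (D.N j)) : 0 < D.lam j k := (D.pixelization j).weight_pos k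

lemma needletCoeff_eq (j : ℕ) (f : Fin (D.N j) → ℝ) (k : Fin (D.N j)) :
    D.needletCoeff j f k = ∑ p, D.lam j p * D.kernel j k p * f p := by
  have h := Real.sqrt_pos.mpr (D.lam_pos j k)
  rw [needletCoeff, Finset.mul_sum]
  refine Finset.sum_congr rfl fun p _ => ?_
  rw [needlet_eq]
  field_simp

lemma noiseLevel_sq (j : ℕ) (k : Fin (D.N j)) : D.noiseLevel j k ^ 2 =
    ∑ p, (D.lam j p * D.kernel j k p * (D.W j p * D.σ j p)) ^ 2 := by
  have h := D.lam_pos j k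
  rw [noiseLevel, Real.sq_sqrt, Finset.mul_sum]
  · refine Finset.sum_congr rfl fun p _ => ?_
    rw [needlet_eq]
    simp only [mul_pow, Real.sq_sqrt h.le]
    field_simp
  · exact mul_nonneg (inv_nonneg.mpr h.le) (Finset.sum_nonneg fun p _ => sq_nonneg _)

variable {Ω : Type*} [MeasurableSpace Ω] {P : Measure Ω} {X : S2 → Ω → ℝ}
  {U : (Σ j : ℕ, Fin (D.N j)) → Ω → ℝ}

namespace IsNoise

variable {D}

lemma memLp (hU : D.IsNoise X U P) (i : Σ j : ℕ, Fin (D.N j)) : MemLp (U i) 2 P := by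
  have h : MemLp id 2 (P.map (U i)) := by
    rw [hU.law i]
    exact memLp_id_gaussianReal 2
  exact h.comp_of_map (hU.measurable i).aemeasurable

lemma integral_eq_zero (hU : D.IsNoise X U P) (i : Σ j : ℕ, Fin (D.N j)) :
    ∫ ω, U i ω ∂P = 0 := by
  have h := integral_map (μ := P) (hU.measurable i).aemeasurable
    (f := fun x : ℝ => x) measurable_id.aestronglyMeasurable
  rw [← h, hU.law i, integral_id_gaussianReal]

lemma integral_sq (hU : D.IsNoise X U P) (i : Σ j : ℕ, Fin (D.N j)) :
    ∫ ω, U i ω ^ 2 ∂P = 1 := by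
  have h1 : Var[fun x : ℝ => x; P.map (U i)] = 1 := by
    rw [hU.law i, variance_fun_id_gaussianReal]; simp
  have h2 : Var[U i; P] = 1 := by
    rw [← h1]
    exact (variance_map (X := fun x : ℝ => x) measurable_id.aemeasurable
      (hU.measurable i).aemeasurable).symm
  rw [variance_of_integral_eq_zero (hU.measurable i).aemeasurable (hU.integral_eq_zero i)] at h2
  exact h2

lemma integral_mul (hU : D.IsNoise X U P) (i i' : Σ j : ℕ, Fin (D.N j)) :
    ∫ ω, U i ω * U i' ω ∂P = if i = i' then 1 else 0 := by
  split_ifs with h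
  · subst h
    simpa only [sq] using hU.integral_sq i
  · have h1 := (hU.indep.indepFun h).integral_fun_mul_eq_mul_integral
      (hU.measurable i).aestronglyMeasurable (hU.measurable i').aestronglyMeasurable
    rw [h1, hU.integral_eq_zero, zero_mul]

lemma integral_field_mul (hU : D.IsNoise X U P) (hX : IsStationaryGaussianField X P) (x : S2)
    (i : Σ j : ℕ, Fin (D.N j)) : ∫ ω, X x ω * U i ω ∂P = 0 := by
  have hind : IndepFun (X x) (U i) P :=
    hU.indep_field.comp (measurable_pi_apply x) (measurable_pi_apply i)
  have h1 := hind.integral_fun_mul_eq_mul_integral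
    (hX.memLp x).aestronglyMeasurable (hU.measurable i).aestronglyMeasurable
  rw [h1, hU.integral_eq_zero, mul_zero]

end IsNoise

variable [IsProbabilityMeasure P]

lemma memLp_signal (hX : IsStationaryGaussianField X P) (j : ℕ) (x : S2) :
    MemLp (D.signal X j x) 2 P :=
  hX.isSquareIntegrableField.memLp_fieldIntegral
    ((continuous_zonal _ _).comp (continuous_dot_right x))

/-- The needlet coefficients of the masked signal. -/
def maskedCoeff (X : S2 → Ω → ℝ) (j : ℕ) (k : Fin (D.N j)) (ω : Ω) : ℝ :=
  ∑ p, D.lam j p * D.kernel j k p * D.W j p * D.signal X j (D.ξ j p) ω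

/-- The needlet coefficients of the signal, without a mask. -/
def fullCoeff (X : S2 → Ω → ℝ) (j : ℕ) (k : Fin (D.N j)) (ω : Ω) : ℝ :=
  ∑ p, D.lam j p * D.kernel j k p * D.signal X j (D.ξ j p) ω

lemma memLp_maskedCoeff (hX : IsStationaryGaussianField X P) (j : ℕ) (k : Fin (D.N j)) :
    MemLp (D.maskedCoeff X j k) 2 P :=
  memLp_finsetSum _ fun p _ => (D.memLp_signal hX j (D.ξ j p)).const_mul _

lemma memLp_fullCoeff (hX : IsStationaryGaussianField X P) (j : ℕ) (k : Fin (D.N j)) :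
    MemLp (D.fullCoeff X j k) 2 P :=
  memLp_finsetSum _ fun p _ => (D.memLp_signal hX j (D.ξ j p)).const_mul _

/-- `n_{j,k}²` is exactly the variance contributed by the masked noise, so subtracting it leaves
only the signal. -/
lemma integrable_and_integral_needletCoeff_sq (hX : IsStationaryGaussianField X P)
    (hU : D.IsNoise X U P) (j : ℕ) (k : Fin (D.N j)) :
    Integrable (fun ω => D.needletCoeff j (fun p => D.obs X U j p ω) k ^ 2) P ∧
      ∫ ω, D.needletCoeff j (fun p => D.obs X U j p ω) k ^ 2 ∂P =
        ∫ ω, D.maskedCoeff X j k ω ^ 2 ∂P + D.noiseLevel j k ^ 2 := by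
  have hae : ∀ᵐ ω ∂P, D.needletCoeff j (fun p => D.obs X U j p ω) k ^ 2 =
      (D.maskedCoeff X j k ω +
        ∑ p, D.lam j p * D.kernel j k p * (D.W j p * D.σ j p) * U ⟨j, p⟩ ω) ^ 2 := by
    filter_upwards [hX.isSquareIntegrableField.integrable_section] with ω hω
    rw [needletCoeff_eq, maskedCoeff, ← Finset.sum_add_distrib]
    congr 1
    refine Finset.sum_congr rfl fun p _ => ?_
    rw [obs, D.lowPass_eq_signal hω]
    ring
  have hSV : ∀ i, ∫ ω, D.maskedCoeff X j k ω * U ⟨j, i⟩ ω ∂P = 0 := by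
    intro i
    simp only [maskedCoeff, Finset.sum_mul, mul_assoc _ (D.signal X j _ _)]
    rw [integral_finsetSum]
    · refine Finset.sum_eq_zero fun p _ => ?_
      have h0 : ∫ ω, D.signal X j (D.ξ j p) ω * U ⟨j, i⟩ ω ∂P = 0 :=
        hX.isSquareIntegrableField.integral_fieldIntegral_mul_eq_zero
          ((continuous_zonal _ _).comp (continuous_dot_right _)) (hU.memLp _)
          (fun y => hU.integral_field_mul hX y _)
      rw [integral_const_mul, h0, mul_zero]
    · intro p _
      exact ((D.memLp_signal hX j _).integrable_mul (hU.memLp ⟨j, i⟩)).const_mul _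
  have hVV : ∀ i i' : Fin (D.N j), ∫ ω, U ⟨j, i⟩ ω * U ⟨j, i'⟩ ω ∂P =
      if i = i' then 1 else 0 := by
    intro i i'
    rw [hU.integral_mul]
    simp
  have h := integrable_and_integral_sq_add_noise (D.memLp_maskedCoeff hX j k)
    (fun i => hU.memLp ⟨j, i⟩) hSV hVV
    (fun p => D.lam j p * D.kernel j k p * (D.W j p * D.σ j p))
  rw [integral_congr_ae hae, integrable_congr hae, noiseLevel_sq]
  exact h

/-- The mean of the estimator. -/
lemma integrable_and_integral_estimator (hX : IsStationaryGaussianField X P)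
    (hU : D.IsNoise X U P) (j : ℕ) (w : Fin (D.N j) → ℝ) :
    Integrable (D.estimator X U j w) P ∧
      ∫ ω, D.estimator X U j w ω ∂P = ∑ k, w k * ∫ ω, D.maskedCoeff X j k ω ^ 2 ∂P := by
  have h := fun k => D.integrable_and_integral_needletCoeff_sq hX hU j k
  have hint : ∀ k, Integrable (fun ω => w k *
      (D.needletCoeff j (fun p => D.obs X U j p ω) k ^ 2 - D.noiseLevel j k ^ 2)) P := fun k =>
    ((h k).1.sub (integrable_const _)).const_mul _
  refine ⟨integrable_finsetSum _ fun k _ => hint k, ?_⟩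
  simp only [estimator]
  rw [integral_finsetSum _ fun k _ => hint k]
  refine Finset.sum_congr rfl fun k _ => ?_
  rw [integral_const_mul, integral_sub (h k).1 (integrable_const _), (h k).2, integral_const]
  simp

/-- The filter is `1` wherever the window may be nonzero, so filtering is invisible to the needlet
coefficients. -/
lemma window_mul_beam (j ℓ : ℕ) : window B a j ℓ * D.beam j ℓ = window B a j ℓ := by
  rcases le_or_gt ℓ (D.L j) with h | h
  · rw [D.beam_low j ℓ h, mul_one]
  · rw [D.window_band j ℓ h, zero_mul]

/-- Exact cubature collapses the sum over pixels: the coefficient is almost surely the convolution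
of `X` with the window kernel at the pixel, and the variance formula applies. -/
lemma integral_fullCoeff_sq (hX : IsStationaryGaussianField X P) (j : ℕ) (k : Fin (D.N j)) :
    ∫ ω, D.fullCoeff X j k ω ^ 2 ∂P = bandSpectrum B a (powerSpectrum X P) j := by
  rw [D.bandSpectrum_eq, ← hX.integral_sq_fieldIntegral_zonal _ _ (D.ξ j k)]
  refine integral_congr_ae ?_
  filter_upwards [hX.isSquareIntegrableField.integrable_section] with ω hω
  congr 1
  have h1 : (fun y => zonal (D.bandwidth j) (window B a j) (dot (D.ξ j k) y)) = fun y =>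
      ∑ p, D.lam j p * D.kernel j k p *
        zonal (D.bandwidth j) (D.beam j) (dot (D.ξ j p) y) := by
    funext y
    have h2 := (D.pixelization j).sum_zonal_mul_zonal (window B a j) (D.beam j) (D.ξ j k) y
    simp only [D.window_mul_beam, ← mul_assoc] at h2
    exact h2.symm
  rw [h1, fieldIntegral_sum hω]
  · rfl
  · exact fun p _ => (continuous_zonal _ _).comp (continuous_dot_right _)

/-- Without a mask the estimator is unbiased. -/
theorem integral_estimator_of_no_mask (hX : IsStationaryGaussianField X P)
    (hU : D.IsNoise X U P) (j : ℕ) (hW : ∀ k, D.W j k = 1) (w : Fin (D.N j) → ℝ)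
    (hw : ∑ k, w k = 1) :
    ∫ ω, D.estimator X U j w ω ∂P = bandSpectrum B a (powerSpectrum X P) j := by
  have h : ∀ k, D.maskedCoeff X j k = D.fullCoeff X j k := by
    intro k
    funext ω
    simp [maskedCoeff, fullCoeff, hW]
  rw [(D.integrable_and_integral_estimator hX hU j w).2]
  simp only [h, D.integral_fullCoeff_sq hX]
  rw [← Finset.sum_mul, hw, one_mul]

end Design

/-! ### Bounds on the window and on the spectrum -/

namespace IsWindowProfile

variable {B : ℝ} {M : ℕ} {a : ℝ → ℝ}

lemma continuous (ha : IsWindowProfile B M a) (hM : 0 < M) : Continuous a := by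
  have h := ha.differentiable 0 hM
  rw [iteratedDeriv_zero] at h
  exact h.continuous

lemma exists_window_bound (ha : IsWindowProfile B M a) (hM : 0 < M) :
    ∃ C, 0 < C ∧ ∀ j ℓ, |window B a j ℓ| ≤ C := by
  have hcs : HasCompactSupport a :=
    HasCompactSupport.of_support_subset_isCompact isCompact_Icc ha.support
  obtain ⟨C, hC⟩ := hcs.exists_bound_of_continuous (ha.continuous hM)
  have hC0 : 0 ≤ C := (norm_nonneg _).trans (hC 0)
  refine ⟨C + C + 1, by positivity, fun j ℓ => ?_⟩
  have h1 : |window B a j ℓ| ≤ |a ((ℓ : ℝ) / B ^ j / B)| + |a ((ℓ : ℝ) / B ^ j)| := abs_sub _ _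
  have h2 := hC ((ℓ : ℝ) / B ^ j / B)
  have h3 := hC ((ℓ : ℝ) / B ^ j)
  rw [Real.norm_eq_abs] at h2 h3
  linarith

/-- The support condition allows `B` itself; continuity and vanishing to the right of `B` exclude
it. -/
lemma apply_right_eq_zero (ha : IsWindowProfile B M a) (hM : 0 < M) : a B = 0 := by
  have h1 : Tendsto a (𝓝[>] B) (𝓝 (a B)) := (ha.continuous hM).continuousWithinAt.tendsto
  have h2 : Tendsto a (𝓝[>] B) (𝓝 0) := by
    refine tendsto_const_nhds.congr' ?_
    filter_upwards [self_mem_nhdsWithin] with x hx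
    by_contra hne
    exact absurd (ha.support (Function.mem_support.mpr (Ne.symm hne))).2 (not_le.mpr hx)
  exact tendsto_nhds_unique h1 h2

/-- The window function is bounded away from zero on an interval of positive reals. -/
lemma exists_interval (ha : IsWindowProfile B M a) (hB : 1 < B) (hM : 0 < M) :
    ∃ u v η : ℝ, 0 < u ∧ u < v ∧ 0 < η ∧ ∀ x ∈ Set.Icc u v, η ≤ |a (x / B) - a x| := by
  have hB0 : 0 < B := by linarith
  have hc : Continuous fun x => |a (x / B) - a x| :=
    (((ha.continuous hM).comp (continuous_id.div_const B)).sub (ha.continuous hM)).abs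
  -- The window function cannot vanish at both `1` and `B`: the first would give `a 1 = 1`, the
  -- second `a 1 = 0`.
  obtain ⟨x₀, hx₀, hne⟩ : ∃ x₀ : ℝ, 0 < x₀ ∧ a (x₀ / B) - a x₀ ≠ 0 := by
    by_contra! hcon
    have h1 := hcon 1 one_pos
    have h2 := hcon B hB0
    have h3 : a (1 / B) = 1 := ha.eq_one _ (by
      rw [one_div]
      have : 0 < B⁻¹ := inv_pos.mpr hB0
      exact ⟨by linarith, le_rfl⟩)
    rw [div_self hB0.ne', ha.apply_right_eq_zero hM] at h2
    rw [h3] at h1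
    linarith
  set η := |a (x₀ / B) - a x₀| / 2 with hη
  have hpos : 0 < |a (x₀ / B) - a x₀| := abs_pos.mpr hne
  have hev : ∀ᶠ x in 𝓝 x₀, η < |a (x / B) - a x| :=
    hc.continuousAt.eventually (lt_mem_nhds (by rw [hη]; linarith))
  obtain ⟨ε, hε, hball⟩ := Metric.eventually_nhds_iff.mp hev
  refine ⟨x₀, x₀ + ε / 2, η, hx₀, by linarith, by positivity, fun x hx => (hball ?_).le⟩
  rw [Real.dist_eq, abs_of_nonneg (by linarith [hx.1])]
  linarith [hx.2]

end IsWindowProfile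

lemma window_zero (B : ℝ) (a : ℝ → ℝ) (j : ℕ) : window B a j 0 = 0 := by simp [window]

/-- Every `ℓ ≥ 1` lies in some `[B^j, B^{j+1})`, where the bounds on `g_j` are uniform in `j`. -/
lemma IsRegularSpectrum.exists_two_sided_bound {B : ℝ} {M : ℕ} {α : ℝ} {C : ℕ → ℝ}
    (hC : IsRegularSpectrum B M α C) (hB : 1 < B) :
    ∃ c, 0 < c ∧ ∀ ℓ : ℕ, 1 ≤ ℓ → c⁻¹ * (ℓ : ℝ) ^ (-α) ≤ C ℓ ∧ C ℓ ≤ c * (ℓ : ℝ) ^ (-α) := by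
  obtain ⟨g, c, hc, hCg, hg, -, -⟩ := hC
  refine ⟨c 0, hc 0 (Nat.zero_le M), fun ℓ hℓ => ?_⟩
  have hB0 : 0 < B := by linarith
  have hℓ' : (1 : ℝ) ≤ ℓ := by exact_mod_cast hℓ
  obtain ⟨j, hj1, hj2⟩ := exists_nat_pow_near hℓ' hB
  have hBj : 0 < B ^ j := by positivity
  have h1 : B ^ ((j : ℤ) - 1) ≤ (ℓ : ℝ) := by
    refine le_trans ?_ hj1
    rw [← zpow_natCast]
    exact zpow_le_zpow_right₀ hB.le (by omega)
  have hmem : (ℓ : ℝ) / B ^ j ∈ Set.Icc B⁻¹ B := by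
    constructor
    · exact (inv_le_one_of_one_le₀ hB.le).trans ((one_le_div hBj).mpr hj1)
    · rw [div_le_iff₀ hBj, ← pow_succ']
      exact hj2.le
  have h2 := hg j _ hmem
  have hp : 0 ≤ (ℓ : ℝ) ^ (-α) := by positivity
  rw [hCg j ℓ h1 hj2.le]
  constructor
  · rw [mul_comm]; exact mul_le_mul_of_nonneg_left h2.1 hp
  · rw [mul_comm (c 0)]; exact mul_le_mul_of_nonneg_left h2.2 hp

lemma IsRegularSpectrum.summable {B : ℝ} {M : ℕ} {α : ℝ} {C : ℕ → ℝ}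
    (hC : IsRegularSpectrum B M α C) (hB : 1 < B) (hα : 2 < α) (hC0 : ∀ ℓ, 0 ≤ C ℓ) :
    Summable fun ℓ : ℕ => (2 * (ℓ : ℝ) + 1) * C ℓ := by
  obtain ⟨c, hc, hb⟩ := hC.exists_two_sided_bound hB
  have h1 : Summable fun ℓ : ℕ => 3 * c * (ℓ : ℝ) ^ (1 - α) :=
    (Real.summable_nat_rpow.mpr (by linarith)).mul_left _
  -- The degree `ℓ = 0`, about which the regularity assumption says nothing, is discarded.
  rw [← summable_nat_add_iff 1] at h1 ⊢
  refine h1.of_nonneg_of_le (fun ℓ => mul_nonneg (by positivity) (hC0 _)) fun ℓ => ?_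
  have hℓ : (0 : ℝ) < ((ℓ + 1 : ℕ) : ℝ) := by positivity
  have h2 := (hb (ℓ + 1) (by omega)).2
  have h3 : ((ℓ + 1 : ℕ) : ℝ) ^ (1 - α) = ((ℓ + 1 : ℕ) : ℝ) * ((ℓ + 1 : ℕ) : ℝ) ^ (-α) := by
    rw [sub_eq_add_neg, Real.rpow_add hℓ, Real.rpow_one]
  have h4 : 2 * ((ℓ + 1 : ℕ) : ℝ) + 1 ≤ 3 * ((ℓ + 1 : ℕ) : ℝ) := by
    have : (1 : ℝ) ≤ ((ℓ + 1 : ℕ) : ℝ) := by exact_mod_cast Nat.le_add_left 1 ℓ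
    linarith
  calc (2 * ((ℓ + 1 : ℕ) : ℝ) + 1) * C (ℓ + 1)
      ≤ (3 * ((ℓ + 1 : ℕ) : ℝ)) * (c * ((ℓ + 1 : ℕ) : ℝ) ^ (-α)) :=
        mul_le_mul h4 h2 (hC0 _) (by positivity)
    _ = 3 * c * ((ℓ + 1 : ℕ) : ℝ) ^ (1 - α) := by rw [h3]; ring

/-- Only finitely many scales escape the asymptotic bound, so a minimum of finitely many constants
suffices. -/
lemma exists_pos_forall_of_eventually {p : ℕ → ℝ → Prop}
    (hmono : ∀ j δ δ', δ' ≤ δ → p j δ → p j δ') (heach : ∀ j, ∃ δ, 0 < δ ∧ p j δ)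
    (hev : ∃ δ J, 0 < δ ∧ ∀ j, J ≤ j → p j δ) : ∃ δ, 0 < δ ∧ ∀ j, p j δ := by
  obtain ⟨δ, J, hδ, hJ⟩ := hev
  have hfin : ∀ n : ℕ, ∃ δ, 0 < δ ∧ ∀ j < n, p j δ := by
    intro n
    induction n with
    | zero => exact ⟨1, one_pos, fun j hj => absurd hj (Nat.not_lt_zero j)⟩
    | succ n ih =>
      obtain ⟨δ₁, h₁, hp₁⟩ := ih
      obtain ⟨δ₂, h₂, hp₂⟩ := heach n
      refine ⟨min δ₁ δ₂, lt_min h₁ h₂, fun j hj => ?_⟩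
      rcases Nat.lt_succ_iff_lt_or_eq.mp hj with h | rfl
      · exact hmono j _ _ (min_le_left _ _) (hp₁ j h)
      · exact hmono j _ _ (min_le_right _ _) hp₂
  obtain ⟨δ', hδ', hp'⟩ := hfin J
  refine ⟨min δ δ', lt_min hδ hδ', fun j => ?_⟩
  rcases le_or_gt J j with h | h
  · exact hmono j _ _ (min_le_left _ _) (hJ j h)
  · exact hmono j _ _ (min_le_right _ _) (hp' j h)

namespace Design

variable {B : ℝ} {a : ℝ → ℝ} {c₀ κ : ℝ} (D : Design B a c₀ κ)

lemma bandSpectrum_pos (D : Design B a c₀ κ) {M : ℕ} {α : ℝ} {C : ℕ → ℝ}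
    (hC : IsRegularSpectrum B M α C) (hB : 1 < B) (hC0 : ∀ ℓ, 0 ≤ C ℓ) {j ℓ : ℕ}
    (hℓ : window B a j ℓ ≠ 0) : 0 < bandSpectrum B a C j := by
  obtain ⟨c, hc, hb⟩ := hC.exists_two_sided_bound hB
  have hℓ1 : 1 ≤ ℓ := by
    rcases ℓ with _ | ℓ
    · exact absurd (window_zero B a j) hℓ
    · omega
  have hCℓ : 0 < C ℓ := by
    refine lt_of_lt_of_le ?_ (hb ℓ hℓ1).1
    have : (0 : ℝ) < ℓ := by exact_mod_cast hℓ1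
    positivity
  have hmem : ℓ ∈ Finset.range (D.bandwidth j) := by
    by_contra h
    exact hℓ (D.window_eq_zero_of_notMem h)
  rw [D.bandSpectrum_eq]
  refine mul_pos (by positivity) (lt_of_lt_of_le ?_ (Finset.single_le_sum
    (f := fun ℓ : ℕ => (2 * (ℓ : ℝ) + 1) * window B a j ℓ ^ 2 * C ℓ) (fun i _ => ?_) hmem))
  · positivity
  · exact mul_nonneg (by positivity) (hC0 i)

/-- The smoothed spectrum is at least of the order `B^{(2-α)j}` at fine scales. -/
lemma exists_bandSpectrum_lower_bound_eventually (D : Design B a c₀ κ) {M : ℕ} {α : ℝ}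
    {C : ℕ → ℝ} (ha : IsWindowProfile B M a) (hM : 0 < M) (hC : IsRegularSpectrum B M α C) (hB : 1 < B)
    (hα : 2 < α) (hC0 : ∀ ℓ, 0 ≤ C ℓ) :
    ∃ (δ : ℝ) (J : ℕ), 0 < δ ∧ ∀ j, J ≤ j →
      δ * (B ^ j) ^ 2 ≤ B ^ (α * (j : ℝ)) * bandSpectrum B a C j := by
  obtain ⟨c, hc, hb⟩ := hC.exists_two_sided_bound hB
  obtain ⟨u, v, η, hu, huv, hη, hwin⟩ := ha.exists_interval hB hM
  have hv : 0 < v := hu.trans huv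
  have hB0 : 0 < B := by linarith
  obtain ⟨J, hJ⟩ := pow_unbounded_of_one_lt (2 / (v - u)) hB
  -- With `R = B^j`, at least `(v-u)R/2` degrees lie in `[uR, vR]`. Each contributes a multiplicity
  -- of at least `2uR`, a squared window of at least `η²` and a spectrum of at least `c⁻¹
  -- (vR)^{-α}`. The choice of `J` makes `(v-u)R ≥ 2`, which absorbs rounding in the count.
  refine ⟨(4 * Real.pi)⁻¹ * ((v - u) / 2 * (2 * u * η ^ 2 * (c⁻¹ * v ^ (-α)))), J,
    by have := sub_pos.mpr huv; positivity, fun j hj => ?_⟩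
  set R := B ^ j with hR
  have hR0 : 0 < R := by positivity
  have hRbig : 2 ≤ (v - u) * R := by
    have h1 : 2 / (v - u) < R := hJ.trans_le (pow_le_pow_right₀ hB.le hj)
    rw [div_lt_iff₀ (sub_pos.mpr huv)] at h1
    linarith
  have hpow : B ^ (α * (j : ℝ)) = R ^ α := by
    rw [mul_comm, Real.rpow_natCast_mul hB0.le]
  set s := Finset.Icc ⌈u * R⌉₊ ⌊v * R⌋₊ with hs
  have hmem : ∀ ℓ ∈ s, u * R ≤ (ℓ : ℝ) ∧ (ℓ : ℝ) ≤ v * R := by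
    intro ℓ hℓ
    rw [hs, Finset.mem_Icc] at hℓ
    exact ⟨Nat.ceil_le.mp hℓ.1, (Nat.le_floor_iff (by positivity)).mp hℓ.2⟩
  have hcard : (v - u) / 2 * R ≤ (s.card : ℝ) := by
    have h1 : (⌈u * R⌉₊ : ℝ) < u * R + 1 := Nat.ceil_lt_add_one (by positivity)
    have h2 : v * R < (⌊v * R⌋₊ : ℝ) + 1 := Nat.lt_floor_add_one _
    rw [hs, Nat.card_Icc]
    have h3 : ((⌊v * R⌋₊ + 1 : ℕ) : ℝ) - (⌈u * R⌉₊ : ℝ) ≤ ((⌊v * R⌋₊ + 1 - ⌈u * R⌉₊ : ℕ) : ℝ) := by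
      rw [sub_le_iff_le_add]
      exact_mod_cast le_tsub_add
    push_cast at h3
    nlinarith
  have hterm : ∀ ℓ ∈ s, 2 * u * R * η ^ 2 * (c⁻¹ * (v * R) ^ (-α)) ≤
      (2 * (ℓ : ℝ) + 1) * window B a j ℓ ^ 2 * C ℓ := by
    intro ℓ hℓ
    obtain ⟨h1, h2⟩ := hmem ℓ hℓ
    have hℓ0 : (0 : ℝ) < ℓ := lt_of_lt_of_le (by positivity) h1
    have hw : η ^ 2 ≤ window B a j ℓ ^ 2 := by
      rw [← sq_abs (window B a j ℓ)]
      exact pow_le_pow_left₀ hη.le (hwin ((ℓ : ℝ) / B ^ j)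
        ⟨(le_div_iff₀ hR0).mpr h1, (div_le_iff₀ hR0).mpr h2⟩) 2
    have hCl : c⁻¹ * (v * R) ^ (-α) ≤ C ℓ := by
      refine le_trans ?_ (hb ℓ (by exact_mod_cast hℓ0)).1
      exact mul_le_mul_of_nonneg_left
        (Real.rpow_le_rpow_of_nonpos hℓ0 h2 (by linarith)) (by positivity)
    refine mul_le_mul (mul_le_mul (by linarith) hw (by positivity) (by positivity)) hCl
      (by positivity) (by positivity)
  have hsub : s ⊆ Finset.range (D.bandwidth j) := by
    intro ℓ hℓ
    by_contra hnot
    obtain ⟨h1, h2⟩ := hmem ℓ hℓ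
    have h3 := hwin ((ℓ : ℝ) / B ^ j) ⟨(le_div_iff₀ hR0).mpr h1, (div_le_iff₀ hR0).mpr h2⟩
    have h4 := D.window_eq_zero_of_notMem hnot
    rw [window] at h4
    rw [h4, abs_zero] at h3
    linarith
  have hsum : (s.card : ℝ) * (2 * u * R * η ^ 2 * (c⁻¹ * (v * R) ^ (-α))) ≤
      ∑ ℓ ∈ Finset.range (D.bandwidth j), (2 * (ℓ : ℝ) + 1) * window B a j ℓ ^ 2 * C ℓ := by
    rw [← nsmul_eq_mul]
    refine (Finset.card_nsmul_le_sum s _ _ hterm).trans ?_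
    exact Finset.sum_le_sum_of_subset_of_nonneg hsub fun ℓ _ _ =>
      mul_nonneg (by positivity) (hC0 ℓ)
  have hRα : R ^ α * (v * R) ^ (-α) = v ^ (-α) := by
    rw [Real.mul_rpow hv.le hR0.le, Real.rpow_neg hR0.le]
    have : R ^ α ≠ 0 := (Real.rpow_pos_of_pos hR0 α).ne'
    field_simp
  rw [hpow, D.bandSpectrum_eq]
  calc (4 * Real.pi)⁻¹ * ((v - u) / 2 * (2 * u * η ^ 2 * (c⁻¹ * v ^ (-α)))) * R ^ 2
      = (4 * Real.pi)⁻¹ * R ^ α *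
          ((v - u) / 2 * R * (2 * u * R * η ^ 2 * (c⁻¹ * (v * R) ^ (-α)))) := by
        rw [← hRα]; ring
    _ ≤ (4 * Real.pi)⁻¹ * R ^ α *
          ((s.card : ℝ) * (2 * u * R * η ^ 2 * (c⁻¹ * (v * R) ^ (-α)))) := by
        refine mul_le_mul_of_nonneg_left (mul_le_mul_of_nonneg_right hcard ?_) ?_ <;> positivity
    _ ≤ (4 * Real.pi)⁻¹ * R ^ α * ∑ ℓ ∈ Finset.range (D.bandwidth j),
          (2 * (ℓ : ℝ) + 1) * window B a j ℓ ^ 2 * C ℓ :=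
        mul_le_mul_of_nonneg_left hsum (by positivity)
    _ = _ := by ring

/-- At every scale the window vanishes or the smoothed spectrum is of the order `B^{(2-α)j}`. -/
lemma exists_bandSpectrum_lower_bound (D : Design B a c₀ κ) {M : ℕ} {α : ℝ} {C : ℕ → ℝ}
    (ha : IsWindowProfile B M a) (hM : 0 < M) (hC : IsRegularSpectrum B M α C) (hB : 1 < B)
    (hα : 2 < α) (hC0 : ∀ ℓ, 0 ≤ C ℓ) :
    ∃ δ : ℝ, 0 < δ ∧ ∀ j, (∀ ℓ, window B a j ℓ = 0) ∨
      δ * (B ^ j) ^ 2 ≤ B ^ (α * (j : ℝ)) * bandSpectrum B a C j := by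
  have hB0 : 0 < B := by linarith
  refine exists_pos_forall_of_eventually (p := fun j δ => (∀ ℓ, window B a j ℓ = 0) ∨
      δ * (B ^ j) ^ 2 ≤ B ^ (α * (j : ℝ)) * bandSpectrum B a C j) ?_ ?_ ?_
  · intro j δ δ' hle h
    refine h.imp_right fun h => le_trans ?_ h
    exact mul_le_mul_of_nonneg_right hle (by positivity)
  · intro j
    by_cases hw : ∀ ℓ, window B a j ℓ = 0
    · exact ⟨1, one_pos, Or.inl hw⟩
    · push Not at hw
      obtain ⟨ℓ, hℓ⟩ := hw
      have hpos := D.bandSpectrum_pos hC hB hC0 hℓ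
      have hR : 0 < (B ^ j) ^ 2 := by positivity
      refine ⟨B ^ (α * (j : ℝ)) * bandSpectrum B a C j / (B ^ j) ^ 2, by positivity, Or.inr ?_⟩
      rw [div_mul_cancel₀ _ hR.ne']
  · obtain ⟨δ, J, hδ, h⟩ := D.exists_bandSpectrum_lower_bound_eventually ha hM hC hB hα hC0
    exact ⟨δ, J, hδ, fun j hj => Or.inr (h j hj)⟩

/-! ### The bias of the masked estimator -/

/-- The squared norm of a normalized needlet. -/
def kernelNormSq (j : ℕ) : ℝ :=
  zonal (D.bandwidth j) (fun ℓ => window B a j ℓ * window B a j ℓ) 1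

lemma sum_kernel_sq (j : ℕ) (k : Fin (D.N j)) :
    ∑ p, D.lam j p * D.kernel j k p ^ 2 = D.kernelNormSq j := by
  have h := (D.pixelization j).sum_zonal_mul_zonal (window B a j) (window B a j)
    (D.ξ j k) (D.ξ j k)
  rw [dot_self] at h
  rw [kernelNormSq, bandwidth, ← h]
  refine Finset.sum_congr rfl fun p _ => ?_
  rw [dot_comm (D.ξ j p) (D.ξ j k), kernel, bandwidth]
  ring

lemma kernelNormSq_le {j : ℕ} {b : ℝ} (hb : ∀ ℓ, |window B a j ℓ| ≤ b) :
    D.kernelNormSq j ≤ (b * D.L j) ^ 2 := by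
  have hL : (1 : ℝ) ≤ D.L j := by exact_mod_cast D.L_pos j
  have hpi := Real.pi_gt_three
  have hsum : ∀ n : ℕ, ∑ ℓ ∈ Finset.range n, (2 * (ℓ : ℝ) + 1) = (n : ℝ) ^ 2 := by
    intro n
    induction n with
    | zero => simp
    | succ n ih => rw [Finset.sum_range_succ, ih]; push_cast; ring
  calc D.kernelNormSq j
      ≤ ∑ ℓ ∈ Finset.range (D.bandwidth j), b ^ 2 / (4 * Real.pi) * (2 * (ℓ : ℝ) + 1) := by
        rw [kernelNormSq, zonal]
        refine Finset.sum_le_sum fun ℓ _ => ?_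
        rw [legendreL_one, ← sq, ← sq_abs, div_mul_eq_mul_div, mul_div_assoc]
        exact mul_le_mul_of_nonneg_right (pow_le_pow_left₀ (abs_nonneg _) (hb ℓ) 2) (by positivity)
    _ = b ^ 2 * ((2 * (D.L j : ℝ) + 1) ^ 2 / (4 * Real.pi)) := by
        rw [← Finset.mul_sum, hsum, bandwidth]
        push_cast
        ring
    -- For `L ≥ 1`, `(2L+1)² ≤ 9L² ≤ 4πL²`.
    _ ≤ b ^ 2 * (D.L j : ℝ) ^ 2 := by
        refine mul_le_mul_of_nonneg_left ?_ (sq_nonneg b)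
        rw [div_le_iff₀ (by positivity)]
        nlinarith
    _ = (b * D.L j) ^ 2 := by ring

lemma inv_sqrt_lam_le (hc₀ : 0 < c₀) (j : ℕ) (k : Fin (D.N j)) :
    (Real.sqrt (D.lam j k))⁻¹ ≤ Real.sqrt c₀ * (4 * D.L j) := by
  have hL : (0 : ℝ) < D.L j := by exact_mod_cast D.L_pos j
  have h := (D.pixelization j).weight_lower k
  push_cast at h
  have h1 : Real.sqrt (c₀⁻¹ * ((4 * (D.L j : ℝ)) ^ 2)⁻¹) = (Real.sqrt c₀ * (4 * D.L j))⁻¹ := by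
    rw [← mul_inv, Real.sqrt_inv, Real.sqrt_mul hc₀.le, Real.sqrt_sq (by positivity)]
  have h2 := Real.sqrt_le_sqrt h
  rw [h1] at h2
  have h3 : 0 < Real.sqrt c₀ * (4 * D.L j) := mul_pos (Real.sqrt_pos.mpr hc₀) (by positivity)
  exact inv_le_of_inv_le₀ h3 h2

/-- The total energy of the signal on the pixels. -/
def pixelEnergy {Ω : Type*} (X : S2 → Ω → ℝ) (j : ℕ) (ω : Ω) : ℝ :=
  ∑ p, D.lam j p * D.signal X j (D.ξ j p) ω ^ 2

lemma abs_weighted_sum_le {ι : Type*} [Fintype ι] (lam x y : ι → ℝ) (hlam : ∀ i, 0 ≤ lam i) :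
    |∑ i, lam i * x i * y i| ≤
      Real.sqrt (∑ i, lam i * x i ^ 2) * Real.sqrt (∑ i, lam i * y i ^ 2) := by
  rw [← Real.sqrt_mul (Finset.sum_nonneg fun i _ => mul_nonneg (hlam i) (sq_nonneg _))]
  refine Real.abs_le_sqrt ?_
  have h := Finset.sum_mul_sq_le_sq_mul_sq Finset.univ (fun i => Real.sqrt (lam i) * x i)
    (fun i => Real.sqrt (lam i) * y i)
  have e1 : ∀ i, Real.sqrt (lam i) * x i * (Real.sqrt (lam i) * y i) = lam i * x i * y i := by
    intro i
    rw [mul_mul_mul_comm, Real.mul_self_sqrt (hlam i), mul_assoc]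
  simpa only [e1, mul_pow, Real.sq_sqrt (hlam _)] using h

/-- The bound holds pathwise. The threshold controls the weighted norm of `(1 - W) ψ_{j,k}`, hence
the difference of the two coefficients; in their sum the factor `1 + W` is merely bounded by 2. -/
lemma abs_maskedCoeff_sq_sub_le {Ω : Type*} (X : S2 → Ω → ℝ) (j : ℕ) {t : ℝ} {k : Fin (D.N j)}
    (hk : k ∈ D.kept j t) (ω : Ω) :
    |D.maskedCoeff X j k ω ^ 2 - D.fullCoeff X j k ω ^ 2| ≤
      2 * t * (Real.sqrt (D.lam j k))⁻¹ * Real.sqrt (D.kernelNormSq j) * D.pixelEnergy X j ω := by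
  have hlam : ∀ p, 0 ≤ D.lam j p := fun p => (D.lam_pos j p).le
  have hsk : 0 < Real.sqrt (D.lam j k) := Real.sqrt_pos.mpr (D.lam_pos j k)
  have hE : 0 ≤ D.pixelEnergy X j ω :=
    Finset.sum_nonneg fun p _ => mul_nonneg (hlam p) (sq_nonneg _)
  have h1 : |D.fullCoeff X j k ω - D.maskedCoeff X j k ω| ≤
      t * (Real.sqrt (D.lam j k))⁻¹ * Real.sqrt (D.pixelEnergy X j ω) := by
    have e : D.fullCoeff X j k ω - D.maskedCoeff X j k ω =
        ∑ p, D.lam j p * ((1 - D.W j p) * D.kernel j k p) * D.signal X j (D.ξ j p) ω := by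
      rw [fullCoeff, maskedCoeff, ← Finset.sum_sub_distrib]
      exact Finset.sum_congr rfl fun p _ => by ring
    rw [e]
    refine (abs_weighted_sum_le _ _ _ hlam).trans ?_
    refine mul_le_mul_of_nonneg_right ?_ (Real.sqrt_nonneg _)
    -- The threshold concerns the needlet, which is `√λ_{j,k}` times the normalized kernel; this
    -- produces the factor `λ_{j,k}^{-1/2}`.
    rw [← div_eq_mul_inv, le_div_iff₀ hsk,
      ← Real.sqrt_mul (Finset.sum_nonneg fun p _ => mul_nonneg (hlam p) (sq_nonneg _))]
    refine le_of_eq_of_le ?_ (show _ ≤ t from hk)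
    congr 1
    rw [Finset.sum_mul]
    refine Finset.sum_congr rfl fun p _ => ?_
    rw [needlet_eq]
    simp only [mul_pow, Real.sq_sqrt (hlam k)]
    ring
  have h2 : |D.fullCoeff X j k ω + D.maskedCoeff X j k ω| ≤
      2 * Real.sqrt (D.kernelNormSq j) * Real.sqrt (D.pixelEnergy X j ω) := by
    have e : D.fullCoeff X j k ω + D.maskedCoeff X j k ω =
        ∑ p, D.lam j p * ((1 + D.W j p) * D.kernel j k p) * D.signal X j (D.ξ j p) ω := by
      rw [fullCoeff, maskedCoeff, ← Finset.sum_add_distrib]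
      exact Finset.sum_congr rfl fun p _ => by ring
    rw [e]
    refine (abs_weighted_sum_le _ _ _ hlam).trans ?_
    refine mul_le_mul_of_nonneg_right ?_ (Real.sqrt_nonneg _)
    rw [show (2 : ℝ) = Real.sqrt (2 ^ 2) by rw [Real.sqrt_sq (by norm_num)],
      ← Real.sqrt_mul (by norm_num), ← D.sum_kernel_sq j k, Finset.mul_sum]
    refine Real.sqrt_le_sqrt (Finset.sum_le_sum fun p _ => ?_)
    have hW := D.W_mem j p
    have h3 : (1 + D.W j p) ^ 2 ≤ 2 ^ 2 :=
      pow_le_pow_left₀ (by linarith [hW.1]) (by linarith [hW.2]) 2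
    calc D.lam j p * ((1 + D.W j p) * D.kernel j k p) ^ 2
        = (1 + D.W j p) ^ 2 * (D.lam j p * D.kernel j k p ^ 2) := by ring
      _ ≤ 2 ^ 2 * (D.lam j p * D.kernel j k p ^ 2) :=
          mul_le_mul_of_nonneg_right h3 (mul_nonneg (hlam p) (sq_nonneg _))
  have e : D.maskedCoeff X j k ω ^ 2 - D.fullCoeff X j k ω ^ 2 =
      -((D.fullCoeff X j k ω - D.maskedCoeff X j k ω) *
        (D.fullCoeff X j k ω + D.maskedCoeff X j k ω)) := by ring
  rw [e, abs_neg, abs_mul]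
  refine (mul_le_mul h1 h2 (abs_nonneg _) ((abs_nonneg _).trans h1)).trans (le_of_eq ?_)
  have hs := Real.mul_self_sqrt hE
  linear_combination (2 * t * (Real.sqrt (D.lam j k))⁻¹ * Real.sqrt (D.kernelNormSq j)) * hs

variable {Ω : Type*} [MeasurableSpace Ω] {P : Measure Ω} [IsProbabilityMeasure P]
  {X : S2 → Ω → ℝ} {U : (Σ j : ℕ, Fin (D.N j)) → Ω → ℝ}

lemma integrable_pixelEnergy (hX : IsStationaryGaussianField X P) (j : ℕ) :
    Integrable (D.pixelEnergy X j) P :=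
  integrable_finsetSum _ fun _ _ => (D.memLp_signal hX j _).integrable_sq.const_mul _

lemma integral_pixelEnergy (hX : IsStationaryGaussianField X P) (j : ℕ) :
    ∫ ω, D.pixelEnergy X j ω ∂P = ∑ ℓ ∈ Finset.range (D.bandwidth j),
      (2 * (ℓ : ℝ) + 1) * D.beam j ℓ ^ 2 * powerSpectrum X P ℓ := by
  simp only [pixelEnergy]
  rw [integral_finsetSum _ fun p _ => (D.memLp_signal hX j (D.ξ j p)).integrable_sq.const_mul _]
  simp only [integral_const_mul, signal, hX.integral_sq_fieldIntegral_zonal]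
  rw [← Finset.sum_mul, (D.pixelization j).sum_weight, mul_inv_cancel_left₀ (by positivity)]

lemma integral_pixelEnergy_le (hX : IsStationaryGaussianField X P) {β : ℝ}
    (hβ : ∀ j ℓ, |D.beam j ℓ| ≤ β)
    (hs : Summable fun ℓ : ℕ => (2 * (ℓ : ℝ) + 1) * powerSpectrum X P ℓ) (j : ℕ) :
    ∫ ω, D.pixelEnergy X j ω ∂P ≤
      β ^ 2 * ∑' ℓ : ℕ, (2 * (ℓ : ℝ) + 1) * powerSpectrum X P ℓ := by
  rw [D.integral_pixelEnergy hX]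
  have hnn : ∀ ℓ : ℕ, 0 ≤ (2 * (ℓ : ℝ) + 1) * powerSpectrum X P ℓ := fun ℓ =>
    mul_nonneg (by positivity) (powerSpectrum_nonneg ℓ)
  calc ∑ ℓ ∈ Finset.range (D.bandwidth j), (2 * (ℓ : ℝ) + 1) * D.beam j ℓ ^ 2 * powerSpectrum X P ℓ
      ≤ ∑ ℓ ∈ Finset.range (D.bandwidth j), β ^ 2 * ((2 * (ℓ : ℝ) + 1) * powerSpectrum X P ℓ) := by
        refine Finset.sum_le_sum fun ℓ _ => ?_
        rw [mul_right_comm, mul_comm]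
        refine mul_le_mul_of_nonneg_right ?_ (hnn ℓ)
        rw [← sq_abs]
        exact pow_le_pow_left₀ (abs_nonneg _) (hβ j ℓ) 2
    _ = β ^ 2 * ∑ ℓ ∈ Finset.range (D.bandwidth j), (2 * (ℓ : ℝ) + 1) * powerSpectrum X P ℓ := by
        rw [Finset.mul_sum]
    _ ≤ _ := mul_le_mul_of_nonneg_left (hs.sum_le_tsum _ fun ℓ _ => hnn ℓ) (sq_nonneg β)

lemma abs_integral_maskedCoeff_sq_sub_le (hX : IsStationaryGaussianField X P) (j : ℕ) {t : ℝ}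
    {k : Fin (D.N j)} (hk : k ∈ D.kept j t) :
    |∫ ω, D.maskedCoeff X j k ω ^ 2 ∂P - bandSpectrum B a (powerSpectrum X P) j| ≤
      2 * t * (Real.sqrt (D.lam j k))⁻¹ * Real.sqrt (D.kernelNormSq j) *
        ∫ ω, D.pixelEnergy X j ω ∂P := by
  rw [← D.integral_fullCoeff_sq hX j k, ← integral_sub (D.memLp_maskedCoeff hX j k).integrable_sq
    (D.memLp_fullCoeff hX j k).integrable_sq, ← integral_const_mul]
  refine abs_integral_le_integral_abs.trans ?_
  exact integral_mono_of_nonneg (Eventually.of_forall fun ω => abs_nonneg _)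
    ((D.integrable_pixelEnergy hX j).const_mul _)
    (Eventually.of_forall fun ω => D.abs_maskedCoeff_sq_sub_le X j hk ω)

/-- The bias of the estimator is controlled by the bias at the kept pixels. -/
lemma abs_integral_estimator_sub_le (hX : IsStationaryGaussianField X P)
    (hU : D.IsNoise X U P) (j : ℕ) {t A b : ℝ} {w : Fin (D.N j) → ℝ} (hw : ∑ k, w k = 1)
    (hwA : ∑ k, |w k| ≤ A) (hkept : ∀ k, k ∉ D.kept j t → w k = 0) (hb0 : 0 ≤ b)
    (hb : ∀ k ∈ D.kept j t,
      |∫ ω, D.maskedCoeff X j k ω ^ 2 ∂P - bandSpectrum B a (powerSpectrum X P) j| ≤ b) :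
    |∫ ω, D.estimator X U j w ω ∂P - bandSpectrum B a (powerSpectrum X P) j| ≤ A * b := by
  have e : ∫ ω, D.estimator X U j w ω ∂P - bandSpectrum B a (powerSpectrum X P) j =
      ∑ k, w k * (∫ ω, D.maskedCoeff X j k ω ^ 2 ∂P -
        bandSpectrum B a (powerSpectrum X P) j) := by
    rw [(D.integrable_and_integral_estimator hX hU j w).2]
    simp only [mul_sub, Finset.sum_sub_distrib]
    rw [← Finset.sum_mul, hw, one_mul]
  rw [e]
  calc |∑ k, w k * (∫ ω, D.maskedCoeff X j k ω ^ 2 ∂P - bandSpectrum B a (powerSpectrum X P) j)|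
      ≤ ∑ k, |w k| * b := by
        refine (Finset.abs_sum_le_sum_abs _ _).trans (Finset.sum_le_sum fun k _ => ?_)
        rw [abs_mul]
        by_cases hk : k ∈ D.kept j t
        · exact mul_le_mul_of_nonneg_left (hb k hk) (abs_nonneg _)
        · simp [hkept k hk]
    _ = (∑ k, |w k|) * b := by rw [Finset.sum_mul]
    _ ≤ A * b := mul_le_mul_of_nonneg_right hwA hb0

end Design

end Needlet

end

/-! ### Assembly of the bias bound and of unbiasedness. -/

theorem proposition7 {Ω : Type*} [MeasurableSpace Ω] (P : Measure Ω) [IsProbabilityMeasure P]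
    (X : Needlet.S2 → Ω → ℝ) (hX : Needlet.IsStationaryGaussianField X P)
    (B : ℝ) (hB : 1 < B) (M : ℕ) (hM : 3 ≤ M)
    (a : ℝ → ℝ) (ha : Needlet.IsWindowProfile B M a)
    (α : ℝ) (hα : 2 < α)
    (hC : Needlet.IsRegularSpectrum B M α (Needlet.powerSpectrum X P))
    (c₀ κ : ℝ) (hc₀ : 0 < c₀) (D : Needlet.Design B a c₀ κ)
    (U : (Σ j : ℕ, Fin (D.N j)) → Ω → ℝ) (hU : D.IsNoise X U P) :
    -- bias bound, for a uniformly bounded low-pass filter and weights bounded in `ℓ¹`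
    (∀ β A : ℝ, (∀ j ℓ, |D.beam j ℓ| ≤ β) →
      ∃ c : ℝ, 0 < c ∧ ∀ (t : ℕ → ℝ) (w : ∀ j, Fin (D.N j) → ℝ) (j : ℕ),
        ∑ k, w j k = 1 → ∑ k, |w j k| ≤ A → (∀ k, k ∉ D.kept j (t j) → w j k = 0) →
        Integrable (D.estimator X U j (w j)) P ∧
        |∫ ω, D.estimator X U j (w j) ω ∂P -
            Needlet.bandSpectrum B a (Needlet.powerSpectrum X P) j| ≤
          c * B ^ (α * (j : ℝ)) * t j *
            Needlet.bandSpectrum B a (Needlet.powerSpectrum X P) j) ∧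
    -- without a mask, unbiasedness for arbitrary weights
    (∀ j : ℕ, (∀ k, D.W j k = 1) → ∀ w : Fin (D.N j) → ℝ, ∑ k, w k = 1 →
      Integrable (D.estimator X U j w) P ∧
      ∫ ω, D.estimator X U j w ω ∂P =
        Needlet.bandSpectrum B a (Needlet.powerSpectrum X P) j) := by
  have hM0 : 0 < M := by omega
  refine ⟨fun β A hβ => ?_, fun j hW w hw =>
    ⟨(D.integrable_and_integral_estimator hX hU j w).1,
      D.integral_estimator_of_no_mask hX hU j hW w hw⟩⟩
  have hC0 : ∀ ℓ, 0 ≤ Needlet.powerSpectrum X P ℓ := Needlet.powerSpectrum_nonneg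
  have hs := hC.summable hB hα hC0
  obtain ⟨b, hb0, hb⟩ := ha.exists_window_bound hM0
  obtain ⟨δ, hδ, hlow⟩ := D.exists_bandSpectrum_lower_bound ha hM0 hC hB hα hC0
  have hS0 : 0 ≤ ∑' ℓ : ℕ, (2 * (ℓ : ℝ) + 1) * Needlet.powerSpectrum X P ℓ :=
    tsum_nonneg fun ℓ => mul_nonneg (by positivity) (hC0 ℓ)
  set E := β ^ 2 * ∑' ℓ : ℕ, (2 * (ℓ : ℝ) + 1) * Needlet.powerSpectrum X P ℓ with hE
  have hE0 : 0 ≤ E := mul_nonneg (sq_nonneg β) hS0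
  have hc₀' : 0 ≤ Real.sqrt c₀ := Real.sqrt_nonneg _
  -- Here `8 = 2 · 4`: the 2 comes from the pathwise bound and the 4 from the pixelization order `4
  -- L_j`.
  set K := 8 * Real.sqrt c₀ * b * κ ^ 2 * E with hK
  have hK0 : 0 ≤ K := by positivity
  -- The absolute value and the added `1` make the constant positive for every `A`, even a negative
  -- one that no weights satisfy.
  refine ⟨|A| * K * δ⁻¹ + 1, by positivity, fun t w j hw hwA hkept => ?_⟩
  refine ⟨(D.integrable_and_integral_estimator hX hU j (w j)).1, ?_⟩
  set C := Needlet.bandSpectrum B a (Needlet.powerSpectrum X P) j with hCdef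
  have hB0 : 0 < B := by linarith
  have hA0 : 0 ≤ A := (Finset.sum_nonneg fun k _ => abs_nonneg (w j k)).trans hwA
  -- Weights summing to 1 cannot all vanish, so some pixel is kept, and its threshold bounds a
  -- square root.
  have ht : 0 ≤ t j := by
    obtain ⟨k, hk⟩ : ∃ k, k ∈ D.kept j (t j) := by
      by_contra! hcon
      simp [fun k => hkept k (hcon k)] at hw
    exact (Real.sqrt_nonneg _).trans hk
  have hen := D.integral_pixelEnergy_le hX hβ hs j
  have hen0 : 0 ≤ ∫ ω, D.pixelEnergy X j ω ∂P := integral_nonneg fun ω =>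
    Finset.sum_nonneg fun p _ => mul_nonneg (D.lam_pos j p).le (sq_nonneg _)
  rcases hlow j with hzero | hlow
  · have hnorm : D.kernelNormSq j = 0 := by
      simp [Needlet.Design.kernelNormSq, Needlet.zonal, hzero]
    have hCz : C = 0 := by rw [hCdef, D.bandSpectrum_eq]; simp [hzero]
    have h := D.abs_integral_estimator_sub_le hX hU j hw hwA hkept le_rfl fun k hk => by
      simpa [hnorm] using D.abs_integral_maskedCoeff_sq_sub_le hX j hk
    rw [← hCdef, mul_zero] at h
    exact h.trans_eq (by rw [hCz, mul_zero])
  · have hL0 : (0 : ℝ) ≤ D.L j := Nat.cast_nonneg _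
    have hkey : ∀ k ∈ D.kept j (t j), |∫ ω, D.maskedCoeff X j k ω ^ 2 ∂P - C| ≤
        K * t j * (B ^ j) ^ 2 := by
      intro k hk
      refine (D.abs_integral_maskedCoeff_sq_sub_le hX j hk).trans ?_
      have h1 := D.inv_sqrt_lam_le hc₀ j k
      have h2 : Real.sqrt (D.kernelNormSq j) ≤ b * D.L j :=
        Real.sqrt_le_iff.mpr ⟨by positivity, D.kernelNormSq_le fun ℓ => hb j ℓ⟩
      have h3 : (D.L j : ℝ) ^ 2 ≤ (κ * B ^ j) ^ 2 := pow_le_pow_left₀ hL0 (D.L_le j) 2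
      calc 2 * t j * (Real.sqrt (D.lam j k))⁻¹ * Real.sqrt (D.kernelNormSq j) *
            ∫ ω, D.pixelEnergy X j ω ∂P
          ≤ 2 * t j * (Real.sqrt c₀ * (4 * D.L j)) * (b * D.L j) * E := by gcongr
        _ = 8 * Real.sqrt c₀ * b * E * t j * (D.L j : ℝ) ^ 2 := by ring
        _ ≤ 8 * Real.sqrt c₀ * b * E * t j * (κ * B ^ j) ^ 2 :=
            mul_le_mul_of_nonneg_left h3 (by positivity)
        _ = K * t j * (B ^ j) ^ 2 := by rw [hK]; ring
    have h := D.abs_integral_estimator_sub_le hX hU j hw hwA hkept (by positivity) hkey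
    -- The growth `B^{2j}` of the absolute bias is traded for `B^{αj} C^{(j)}`, which makes the
    -- bound relative.
    have hlow' : (B ^ j) ^ 2 ≤ δ⁻¹ * (B ^ (α * (j : ℝ)) * C) := by
      rw [inv_mul_eq_div, le_div_iff₀ hδ]
      linarith
    have hBC : 0 ≤ B ^ (α * (j : ℝ)) * C :=
      le_trans (by positivity) hlow
    calc |∫ ω, D.estimator X U j (w j) ω ∂P - C|
        ≤ A * (K * t j * (B ^ j) ^ 2) := h
      _ = A * K * t j * (B ^ j) ^ 2 := by ring
      _ ≤ A * K * t j * (δ⁻¹ * (B ^ (α * (j : ℝ)) * C)) :=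
          mul_le_mul_of_nonneg_left hlow' (by positivity)
      _ = |A| * K * δ⁻¹ * (t j * (B ^ (α * (j : ℝ)) * C)) := by rw [abs_of_nonneg hA0]; ring
      _ ≤ (|A| * K * δ⁻¹ + 1) * (t j * (B ^ (α * (j : ℝ)) * C)) :=
          mul_le_mul_of_nonneg_right (by linarith) (mul_nonneg ht hBC)
      _ = (|A| * K * δ⁻¹ + 1) * B ^ (α * (j : ℝ)) * t j * C := by ring
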